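/- Let $(X_t)_{t\in\mathbb Z}$ be a strictly stationary sequence of real random variables with generic element $X$, regularly varying with index $\alpha>1$, i.e. for every $k\ge1$ there is a random vector $\Theta^{(k)}$ with values in the Euclidean unit sphere of $\mathbb R^k$ such that $Z=(X_1,\dots,X_k)$ satisfies $$\frac{\mathbb P(|Z|>ux,\ Z/|Z|\in\cdot)}{\mathbb P(|Z|>x)}\ \xrightarrow{w}\ u^{-\alpha}\,\mathbb P(\Theta^{(k)}\in\cdot),\qquad x\to\infty,\quad u>0 .$$ Let $(Y_t)_{t\in\mathbb Z}$ be its tail process, i.e. $\mathbb P(|Y_0|>y)=y^{-\alpha}$ for $y>1$ and, for every $k\ge 0$, the law of $x^{-1}(X_{-k},\dots,X_k)$ given $|X_0|>x$ converges weakly to the law of $(Y_{-k},\dots,Y_k)$ as $x\to\infty$, and let $\Theta_t=Y_t/|Y_0|$, $t\in\mathbb Z$, be its spectral tail process. Put $S_0=0$, $S_t=X_1+\dots+X_t$, and $M_{k,n}=\max_{k\le i\le n}|X_i|$. Assume that $\mathbb E X=0$ and that for all constants $0<C_1<C_2$ the following two conditions hold with $\Lambda_n=[C_1n,C_2n]$: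 1. (anti-clustering) for every $\delta>0$, $$\lim_{k\to\infty}\limsup_{n\to\infty}\sup_{x\in\Lambda_n}\mathbb P\big(M_{k,n}>x\delta\,\big|\,|X_0|>x\delta\big)=0;$$ 2. (vanishing small values) for every $\delta>0$, $$\lim_{\varepsilon\downarrow0}\limsup_{n\to\infty}\sup_{x\in\Lambda_n}\frac{\mathbb P\big(x^{-1}\sup_{t\le n}\big|\sum_{i=1}^tX_i\mathbf 1_{\{|X_i|\le\varepsilon x\}}\big|>\delta\big)}{n\,\mathbb P(|X|>x)}=0 .$$ Assume moreover that $$\mathbb E\Big(\sum_{i=1}^\infty|\Theta_i|\Big)^{\alpha-1}<\infty .$$ Then the random variable $\big(\sup_{t\ge0}\sum_{i=0}^t\Theta_i\big)_+^\alpha-\big(\sup_{t\ge1}\sum_{i=1}^t\Theta_i\big)_+^\alpha$ is integrable, and for every $\rho>0$, $$\lim_{x\to\infty}\frac{\mathbb P\big(\sup_{t\ge0}(S_t-\rho t)>x\big)}{x\,\mathbb P(|X|>x)}=\frac{\mathbb E\Big[\big(\sup_{t\ge0}\sum_{i=0}^t\Theta_i\big)_+^\alpha-\big(\sup_{t\ge1}\sum_{i=1}^t\Theta_i\big)_+^\alpha\Big]}{(\alpha-1)\rho}.$$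 -/

import Mathlib

open MeasureTheory ProbabilityTheory Filter Topology
open scoped ENNReal BoundedContinuousFunction

namespace RuinLD

noncomputable section

/-- A random vector `Z` is regularly varying with index `α`: there is a probability measure `σ` on
the unit sphere (the spectral measure) such that, for every `u > 0`, the finite measures
`P(‖Z‖ > u x, Z / ‖Z‖ ∈ ·) / P(‖Z‖ > x)` converge weakly to `u ^ (-α) σ` as `x → ∞`.
The measures are regarded as measures on `E` carried by the unit sphere, which is closed, and weak
convergence is tested on bounded continuous functions. -/
def RegularlyVaryingVector {Ω E : Type*} [MeasurableSpace Ω] [NormedAddCommGroup E]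
    [NormedSpace ℝ E] [MeasurableSpace E] (P : Measure Ω) (α : ℝ) (Z : Ω → E) : Prop :=
  ∃ σ : Measure E, IsProbabilityMeasure σ ∧ σ (Metric.sphere (0 : E) 1)ᶜ = 0 ∧
    ∀ u : ℝ, 0 < u → ∀ f : E →ᵇ ℝ,
      Tendsto
        (fun x : ℝ =>
          (∫ ω in {ω | u * x < ‖Z ω‖}, f (‖Z ω‖⁻¹ • Z ω) ∂P) / P.real {ω | x < ‖Z ω‖})
        atTop (𝓝 (u ^ (-α) * ∫ θ, f θ ∂σ))

/-- Strict stationarity of a real sequence indexed by `ℤ`. -/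
def StrictlyStationary {Ω : Type*} [MeasurableSpace Ω] (P : Measure Ω) (X : ℤ → Ω → ℝ) : Prop :=
  ∀ h : ℤ, IdentDistrib (fun ω (t : ℤ) => X (t + h) ω) (fun ω (t : ℤ) => X t ω) P P

/-- The sequence `(X_t)` is regularly varying with index `α`: every lagged vector
`(X_1, …, X_k)`, `k ≥ 1`, is regularly varying with index `α` (Euclidean norm). -/
def RegularlyVaryingSeq {Ω : Type*} [MeasurableSpace Ω] (P : Measure Ω) (α : ℝ)
    (X : ℤ → Ω → ℝ) : Prop :=
  ∀ k : ℕ, 1 ≤ k →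
    RegularlyVaryingVector P α
      (fun ω => (WithLp.toLp 2 (fun i : Fin k => X (((i : ℕ) : ℤ) + 1) ω) : EuclideanSpace ℝ (Fin k)))

/-- `(Y_t)`, defined on a probability space `(Ω', Q)`, is a tail process of `(X_t)`:
`|Y_0|` is Pareto distributed with index `α` and, for every `k ≥ 0`, the law of
`x⁻¹ (X_{-k}, …, X_k)` given `|X_0| > x` converges weakly to the law of `(Y_{-k}, …, Y_k)`. -/
structure IsTailProcess {Ω Ω' : Type*} [MeasurableSpace Ω] [MeasurableSpace Ω']
    (P : Measure Ω) (α : ℝ) (X : ℤ → Ω → ℝ) (Q : Measure Ω') (Y : ℤ → Ω' → ℝ) : Prop where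
  measurable : ∀ t, Measurable (Y t)
  pareto : ∀ y : ℝ, 1 < y → Q.real {ω | y < |Y 0 ω|} = y ^ (-α)
  tendsto : ∀ (k : ℕ) (f : (Set.Icc (-(k : ℤ)) (k : ℤ) → ℝ) →ᵇ ℝ),
    Tendsto (fun x : ℝ => ∫ ω, f (fun i => x⁻¹ * X i ω) ∂(P[|{ω | x < |X 0 ω|}]))
      atTop (𝓝 (∫ ω, f (fun i => Y i ω) ∂Q))

/-- The spectral tail process `Θ_t = Y_t / |Y_0|` built from a tail process `(Y_t)`. -/
def spectralTail {Ω' : Type*} (Y : ℤ → Ω' → ℝ) (t : ℤ) (ω : Ω') : ℝ := Y t ω / |Y 0 ω|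

/-- `M_{k,n} = max_{k ≤ i ≤ n} |X_i|` (with the value `0` if `n < k`). -/
def maxAbs {Ω : Type*} (X : ℤ → Ω → ℝ) (k n : ℕ) (ω : Ω) : ℝ :=
  ⨆ i : Set.Icc k n, |X ((i : ℕ) : ℤ) ω|

/-- The partial sums `S_0 = 0`, `S_t = X_1 + ⋯ + X_t`. -/
def partialSum {Ω : Type*} (X : ℤ → Ω → ℝ) (t : ℕ) (ω : Ω) : ℝ :=
  ∑ i ∈ Finset.Icc (1 : ℕ) t, X ((i : ℕ) : ℤ) ω

/-- The truncated variables `X_t 1_{|X_t| ≤ c}`. -/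
def trunc {Ω : Type*} (c : ℝ) (X : ℤ → Ω → ℝ) (t : ℤ) (ω : Ω) : ℝ :=
  if |X t ω| ≤ c then X t ω else 0

/-- Uniform anti-clustering condition along the sets `Λ_n`: for every `δ > 0`,
`lim_{k → ∞} limsup_{n → ∞} sup_{x ∈ Λ_n} P(M_{k,n} > x δ | |X_0| > x δ) = 0`. -/
def AntiClustering {Ω : Type*} [MeasurableSpace Ω] (P : Measure Ω) (X : ℤ → Ω → ℝ)
    (Λ : ℕ → Set ℝ) : Prop :=
  ∀ δ : ℝ, 0 < δ →
    Tendsto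
      (fun k : ℕ => limsup
        (fun n : ℕ => ⨆ x ∈ Λ n,
          (P[|{ω | x * δ < |X 0 ω|}]) {ω | x * δ < maxAbs X k n ω}) atTop)
      atTop (𝓝 (0 : ℝ≥0∞))

/-- Vanishing-small-values condition along the sets `Λ_n`: for every `δ > 0`,
`lim_{ε ↓ 0} limsup_{n → ∞} sup_{x ∈ Λ_n}
  P(x⁻¹ sup_{t ≤ n} |∑_{i ≤ t} X_i 1_{|X_i| ≤ ε x}| > δ) / (n P(|X| > x)) = 0`.
The quotients are taken in `[0, ∞]`. -/
def VanishingSmallValues {Ω : Type*} [MeasurableSpace Ω] (P : Measure Ω) (X : ℤ → Ω → ℝ)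
    (Λ : ℕ → Set ℝ) : Prop :=
  ∀ δ : ℝ, 0 < δ →
    Tendsto
      (fun ε : ℝ => limsup
        (fun n : ℕ => ⨆ x ∈ Λ n,
          P {ω | δ < x⁻¹ * ⨆ t : Set.Iic n, |partialSum (trunc (ε * x) X) t ω|} /
            ((n : ℝ≥0∞) * P {ω | x < |X 0 ω|})) atTop)
      (𝓝[>] 0) (𝓝 (0 : ℝ≥0∞))

/-- The random variable
`(sup_{t ≥ 0} ∑_{i=0}^t Θ_i)_+ ^ α - (sup_{t ≥ 1} ∑_{i=1}^t Θ_i)_+ ^ α`. -/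
def ruinFunctional {Ω' : Type*} (α : ℝ) (Θ : ℤ → Ω' → ℝ) (ω : Ω') : ℝ :=
  (max (⨆ t : ℕ, ∑ i ∈ Finset.Icc (0 : ℕ) t, Θ ((i : ℕ) : ℤ) ω) 0) ^ α -
    (max (⨆ t : Set.Ici (1 : ℕ), ∑ i ∈ Finset.Icc (1 : ℕ) t, Θ ((i : ℕ) : ℤ) ω) 0) ^ α

/-- The ruin probability `P(sup_{t ≥ 0} (S_t - ρ t) > x)`; the supremum is taken in
`[-∞, ∞]`. -/
def ruinProb {Ω : Type*} [MeasurableSpace Ω] (P : Measure Ω) (X : ℤ → Ω → ℝ) (ρ x : ℝ) : ℝ :=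
  P.real {ω | (x : EReal) < ⨆ t : ℕ, ((partialSum X t ω - ρ * t : ℝ) : EReal)}

end

end RuinLD

/-!
The ruin event is caused by one cluster of large increments, located somewhere on the time scale
`x`. Fix a small `ε` and a large horizon `M x`, and split each increment into its part of modulus
at most `ε x` and the rest (`cut`).

*Reduction to large increments on a finite horizon.* By the vanishing-small-values condition the
small parts move the walk by more than `δ x` before time `M x` only with a probability that is a
small multiple of `x P(|X| > x)` when `ε` is small. Crossings after time `M x` are treated on dyadic blocks
(`exists_measureReal_late_crossing_le`): the walk has to exceed a multiple of `2 ^ j M x` before the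
time `2 ^ (j + 1) M x`, and since the tail has index `-α` with `α > 1` these probabilities sum to a
small multiple of `x P(|X| > x)`.

*From the crossing event to one cluster.* For the walk with large increments let `E i` be the event
that the sequence started at time `i` crosses the level `a x + ρ j` (`CrossesFrom`). The probability
of `E 0` is the telescoping sum of `P (E i) - P (E (i + 1))`. Such a difference only charges
`|X_i| > ε x`, because otherwise starting at `i` or at `i + 1` is the same thing, and then forward
anti-clustering confines all further large increments to the next `k` steps. By stationarity the
`i`-th difference can be evaluated at the origin; summing over `i` counts how many levels
`a x + ρ i` lie below the maximum `posMax` of the partial sums of the cluster with, respectively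
without, its first element. Up to bounded errors this count is the difference `gain` of two ramp
functions (`abs_crossing_sub_gain_le`). No information about the past of the cluster enters.

*The limit.* Divided by `P(|X| > x)`, the expectation of `gain` tends to an integral over `(r, Θ)`
against the product of the power measure `α r ^ (-α - 1) dr` and the law of `Θ`
(`IsTailProcess.map_polar`, `IsTailProcess.tendsto_gain`); the threshold causes no discontinuity
since the limit laws do not charge it. The polar decomposition itself follows from regular variation
of the marginal tail by conditioning on `|X_0| > u x` instead of `|X_0| > x`.

*Removing the truncations.* With `W = 1 + ∑_{i ≥ 1} |Θ_i|` all integrands are dominated by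
`(r / ρ) 1{r W > 1 / 2}`, whose integral is a constant times `E W ^ (α - 1)`; this is where the
moment assumption is used. Dominated convergence (`tendsto_clusterLimit`) gives the integral of
`((r A - 1)_+ - (r B - 1)_+) / ρ`, where `A`, `B` are the two positive parts of suprema in the
statement, and `∫ α r ^ (-α - 1) (r A - 1)_+ dr = A ^ α / (α - 1)` (`powerMeasure_ramp`) evaluates
it. The same domination yields the integrability of `A ^ α - B ^ α`, which need not hold for
`A ^ α` and `B ^ α` separately.
-/

namespace RuinLD

noncomputable section

/-! ### Maxima of partial sums and threshold counting -/

/-- Hard thresholding: `y` is kept if `|y| > c` and replaced by `0` otherwise. -/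
def cut (c y : ℝ) : ℝ := if c < |y| then y else 0

/-- The maximum of the partial sums `∑_{j < s} z_j` over `0 ≤ s ≤ k`. The empty sum is included,
so this is the positive part of the maximum over `1 ≤ s ≤ k`. -/
def posMax (k : ℕ) (z : ℕ → ℝ) : ℝ :=
  (Finset.range (k + 1)).sup' Finset.nonempty_range_add_one (fun s => ∑ j ∈ Finset.range s, z j)

/-- The ramp `b ↦ min M ((b - a)₊ / ρ)`: the length of the set of times `v ∈ [0, M]` at which the
moving level `a + ρ v` is below `b`. -/
def ramp (ρ M a b : ℝ) : ℝ := min M (max ((b - a) / ρ) 0)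

/-- The change of the ramp functional of the maximal partial sum caused by the first entry of `z`.
Its expectation is the contribution of the time points to the ruin probability. -/
def gain (ρ M a : ℝ) (k : ℕ) (z : ℕ → ℝ) : ℝ :=
  ramp ρ M a (posMax (k + 1) z) - ramp ρ M a (posMax k (fun j => z (j + 1)))

lemma lt_posMax_iff {k : ℕ} {z : ℕ → ℝ} {b : ℝ} :
    b < posMax k z ↔ ∃ s ≤ k, b < ∑ j ∈ Finset.range s, z j := by
  simp [posMax, Finset.lt_sup'_iff]

lemma posMax_le_iff {k : ℕ} {z : ℕ → ℝ} {b : ℝ} :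
    posMax k z ≤ b ↔ ∀ s ≤ k, ∑ j ∈ Finset.range s, z j ≤ b := by
  simp [posMax, Finset.sup'_le_iff]

lemma sum_le_posMax {k s : ℕ} (z : ℕ → ℝ) (hs : s ≤ k) :
    ∑ j ∈ Finset.range s, z j ≤ posMax k z :=
  posMax_le_iff.1 le_rfl s hs

lemma posMax_nonneg (k : ℕ) (z : ℕ → ℝ) : 0 ≤ posMax k z := by
  simpa using sum_le_posMax z (Nat.zero_le k)

lemma posMax_le_add (k : ℕ) (z w : ℕ → ℝ) :
    posMax k z ≤ posMax k w + ∑ j ∈ Finset.range k, |z j - w j| := by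
  refine posMax_le_iff.2 fun s hs => ?_
  have h1 := sum_le_posMax w hs
  have h2 : ∑ j ∈ Finset.range s, (z j - w j) ≤ ∑ j ∈ Finset.range s, |z j - w j| :=
    Finset.sum_le_sum fun j _ => le_abs_self _
  have h3 : ∑ j ∈ Finset.range s, |z j - w j| ≤ ∑ j ∈ Finset.range k, |z j - w j| :=
    Finset.sum_le_sum_of_subset_of_nonneg (Finset.range_mono hs) fun _ _ _ => abs_nonneg _
  rw [Finset.sum_sub_distrib] at h2
  linarith

lemma abs_posMax_sub_le (k : ℕ) (z w : ℕ → ℝ) :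
    |posMax k z - posMax k w| ≤ ∑ j ∈ Finset.range k, |z j - w j| := by
  have h1 := posMax_le_add k z w
  have h2 := posMax_le_add k w z
  simp only [abs_sub_comm (w _)] at h2
  rw [abs_le]
  constructor <;> linarith

lemma posMax_le_sum_abs (k : ℕ) (z : ℕ → ℝ) : posMax k z ≤ ∑ j ∈ Finset.range k, |z j| := by
  refine posMax_le_iff.2 fun s hs => ?_
  refine (Finset.sum_le_sum fun j _ => le_abs_self _).trans ?_
  exact Finset.sum_le_sum_of_subset_of_nonneg (Finset.range_mono hs) fun _ _ _ => abs_nonneg _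

lemma posMax_congr {k : ℕ} {z w : ℕ → ℝ} (h : ∀ j < k, z j = w j) : posMax k z = posMax k w := by
  have := abs_posMax_sub_le k z w
  rw [Finset.sum_eq_zero fun j hj => by rw [h j (Finset.mem_range.1 hj), sub_self, abs_zero]] at this
  linarith [abs_nonpos_iff.1 this]

lemma posMax_const_mul {c : ℝ} (hc : 0 ≤ c) (k : ℕ) (z : ℕ → ℝ) :
    posMax k (fun j => c * z j) = c * posMax k z := by
  unfold posMax
  simp only [← Finset.mul_sum]
  exact (Finset.apply_sup'_eq_sup'_comp Finset.nonempty_range_add_one (fun x => c * x)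
    (fun x y => mul_max_of_nonneg x y hc)).symm

lemma abs_posMax_succ_sub_le (k : ℕ) (z : ℕ → ℝ) :
    |posMax (k + 1) z - posMax k (fun j => z (j + 1))| ≤ |z 0| := by
  have h1 : posMax (k + 1) z ≤ posMax k (fun j => z (j + 1)) + |z 0| := by
    refine posMax_le_iff.2 fun s hs => ?_
    rcases s with _ | s
    · simpa using add_nonneg (posMax_nonneg _ _) (abs_nonneg _)
    · rw [Finset.sum_range_succ']
      exact add_le_add (sum_le_posMax (fun j => z (j + 1)) (by omega)) (le_abs_self _)
  have h2 : posMax k (fun j => z (j + 1)) ≤ posMax (k + 1) z + |z 0| := by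
    refine posMax_le_iff.2 fun s hs => ?_
    have := sum_le_posMax z (show s + 1 ≤ k + 1 by omega)
    rw [Finset.sum_range_succ'] at this
    linarith [neg_abs_le (z 0)]
  rw [abs_le]
  constructor <;> linarith

lemma continuous_posMax (k : ℕ) : Continuous (posMax k) := by
  unfold posMax
  exact Continuous.finset_sup'_apply Finset.nonempty_range_add_one fun s _ => by fun_prop

lemma measurable_cut (c : ℝ) : Measurable (cut c) :=
  Measurable.ite (measurableSet_lt measurable_const measurable_id.abs) measurable_id
    measurable_const

lemma cut_zero (c : ℝ) : cut c 0 = 0 := by simp [cut]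

lemma cut_eq_zero {c y : ℝ} (h : |y| ≤ c) : cut c y = 0 := if_neg h.not_gt

lemma abs_cut_le (c y : ℝ) : |cut c y| ≤ |y| := by
  unfold cut; split_ifs <;> simp

lemma cut_mul {x : ℝ} (hx : 0 < x) (c y : ℝ) : cut (c * x) (x * y) = x * cut c y := by
  unfold cut
  have : c * x < |x * y| ↔ c < |y| := by
    rw [abs_mul, abs_of_pos hx, mul_comm c, mul_lt_mul_iff_right₀ hx]
  simp only [this]; split_ifs <;> simp

lemma continuousAt_cut {c y : ℝ} (h : |y| ≠ c) : ContinuousAt (cut c) y := by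
  rcases h.lt_or_gt with h | h
  · refine (continuousAt_const (y := (0 : ℝ))).congr ?_
    filter_upwards [continuous_abs.continuousAt.eventually (gt_mem_nhds h)] with z hz
    exact (cut_eq_zero hz.le).symm
  · refine continuousAt_id.congr ?_
    filter_upwards [continuous_abs.continuousAt.eventually (lt_mem_nhds h)] with z hz
    exact (if_pos hz).symm

lemma ramp_nonneg {M : ℝ} (hM : 0 ≤ M) (ρ a b : ℝ) : 0 ≤ ramp ρ M a b :=
  le_min hM (le_max_right _ _)

lemma ramp_le (ρ M a b : ℝ) : ramp ρ M a b ≤ M := min_le_left _ _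

lemma abs_ramp_sub_le {ρ : ℝ} (hρ : 0 < ρ) (M a a' b b' : ℝ) :
    |ramp ρ M a b - ramp ρ M a' b'| ≤ |(b - a) - (b' - a')| / ρ := by
  unfold ramp
  refine (abs_min_sub_min_le_max _ _ _ _).trans ?_
  rw [sub_self, abs_zero, max_eq_right (abs_nonneg _)]
  refine (abs_max_sub_max_le_max _ _ _ _).trans ?_
  rw [sub_self, abs_zero, max_eq_left (abs_nonneg _), ← sub_div, abs_div, abs_of_pos hρ]

lemma ramp_eq_zero {ρ M a b : ℝ} (hρ : 0 < ρ) (hM : 0 ≤ M) (h : b ≤ a) : ramp ρ M a b = 0 := by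
  unfold ramp
  rw [max_eq_right (div_nonpos_of_nonpos_of_nonneg (by linarith) hρ.le), min_eq_right hM]

lemma abs_ramp_horizon_sub_le (ρ M M' a b : ℝ) : |ramp ρ M a b - ramp ρ M' a b| ≤ |M - M'| := by
  unfold ramp
  refine (abs_min_sub_min_le_max _ _ _ _).trans ?_
  simp

lemma ramp_mul {x : ℝ} (hx : 0 < x) (ρ M a b : ℝ) :
    ramp ρ (x * M) (x * a) (x * b) = x * ramp ρ M a b := by
  unfold ramp
  rw [mul_min_of_nonneg _ _ hx.le, mul_max_of_nonneg _ _ hx.le, mul_zero, ← mul_sub, mul_div_assoc]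

lemma continuous_ramp (ρ M a : ℝ) : Continuous (ramp ρ M a) := by
  unfold ramp; fun_prop

lemma continuous_gain (ρ M a : ℝ) (k : ℕ) : Continuous (gain ρ M a k) := by
  unfold gain
  refine ((continuous_ramp ρ M a).comp (continuous_posMax _)).sub
    ((continuous_ramp ρ M a).comp ((continuous_posMax _).comp (by fun_prop)))

lemma abs_gain_le {M : ℝ} (hM : 0 ≤ M) (ρ a : ℝ) (k : ℕ) (z : ℕ → ℝ) : |gain ρ M a k z| ≤ M := by
  unfold gain
  rw [abs_le]
  constructor <;>
  linarith [ramp_le ρ M a (posMax (k + 1) z), ramp_nonneg hM ρ a (posMax (k + 1) z),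
    ramp_le ρ M a (posMax k (fun j => z (j + 1))), ramp_nonneg hM ρ a (posMax k (fun j => z (j + 1)))]

lemma gain_congr {ρ M a : ℝ} {k : ℕ} {z w : ℕ → ℝ} (h : ∀ j ≤ k, z j = w j) :
    gain ρ M a k z = gain ρ M a k w := by
  unfold gain
  rw [posMax_congr fun j hj => h j (by omega : j ≤ k),
    posMax_congr fun j (hj : j < k) => h (j + 1) (by omega)]

lemma gain_mul {x : ℝ} (hx : 0 < x) (ρ M a : ℝ) (k : ℕ) (z : ℕ → ℝ) :
    gain ρ (x * M) (x * a) k (fun j => x * z j) = x * gain ρ M a k z := by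
  unfold gain
  rw [posMax_const_mul hx.le, posMax_const_mul hx.le k (fun j => z (j + 1)), ramp_mul hx,
    ramp_mul hx, mul_sub]

lemma abs_gain_horizon_sub_le (ρ M M' a : ℝ) (k : ℕ) (z : ℕ → ℝ) :
    |gain ρ M a k z - gain ρ M' a k z| ≤ 2 * |M - M'| := by
  unfold gain
  have h1 := abs_ramp_horizon_sub_le ρ M M' a (posMax (k + 1) z)
  have h2 := abs_ramp_horizon_sub_le ρ M M' a (posMax k (fun j => z (j + 1)))
  rw [abs_le] at *
  constructor <;> linarith [h1.1, h1.2, h2.1, h2.2]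

/-- The bound that makes the limit exchangeable: the gain is Lipschitz in the first entry, and it
vanishes unless the total absolute sum exceeds the level. -/
lemma abs_gain_le_of_sum {ρ M a W : ℝ} (hρ : 0 < ρ) (hM : 0 ≤ M) (k : ℕ) (z : ℕ → ℝ)
    (hW : ∑ j ∈ Finset.range (k + 1), |z j| ≤ W) :
    |gain ρ M a k z| ≤ if a < W then |z 0| / ρ else 0 := by
  split_ifs with h
  · unfold gain
    refine (abs_ramp_sub_le hρ M a a _ _).trans ?_
    rw [sub_sub_sub_cancel_right]
    exact div_le_div_of_nonneg_right (abs_posMax_succ_sub_le k z) hρ.le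
  · have h1 : posMax (k + 1) z ≤ W := (posMax_le_sum_abs _ _).trans hW
    have h2 : posMax k (fun j => z (j + 1)) ≤ W := by
      refine (posMax_le_sum_abs _ _).trans (le_trans ?_ hW)
      rw [Finset.sum_range_succ']
      linarith [abs_nonneg (z 0)]
    unfold gain
    rw [ramp_eq_zero hρ hM (by linarith), ramp_eq_zero hρ hM (by linarith)]
    simp

/-- The number of `i < n` with `A + ρ i < b`. -/
def levelCount (ρ : ℝ) (n : ℕ) (A b : ℝ) : ℝ :=
  ∑ i ∈ Finset.range n, if A + ρ * i < b then (1 : ℝ) else 0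

lemma abs_levelCount_sub_ramp_le {ρ : ℝ} (hρ : 0 < ρ) (n : ℕ) (A b : ℝ) :
    |levelCount ρ n A b - ramp ρ n A b| ≤ 1 := by
  have key : levelCount ρ n A b = min (n : ℝ) (⌈(b - A) / ρ⌉₊ : ℝ) := by
    unfold levelCount
    rw [Finset.sum_boole]
    have : (Finset.range n).filter (fun i : ℕ => A + ρ * i < b)
        = Finset.range (min n ⌈(b - A) / ρ⌉₊) := by
      ext i
      have : A + ρ * i < b ↔ i < ⌈(b - A) / ρ⌉₊ := by
        rw [Nat.lt_ceil, lt_div_iff₀ hρ]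
        constructor <;> intro h <;> linarith
      simp [this]
    rw [this, Finset.card_range, Nat.cast_min]
  rw [key]
  unfold ramp
  refine (abs_min_sub_min_le_max _ _ _ _).trans ?_
  rw [sub_self, abs_zero, max_eq_right (abs_nonneg _)]
  rcases le_total ((b - A) / ρ) 0 with h | h
  · rw [Nat.ceil_eq_zero.2 h, max_eq_right h]; simp
  · rw [max_eq_left h, abs_le]
    have h1 := Nat.le_ceil ((b - A) / ρ)
    have h2 := Nat.ceil_lt_add_one h
    constructor <;> linarith

/-! ### Crossing a moving level -/

/-- The sums of `w` started at time `i` cross the level `A + ρ t` at some time `t ≤ N`. -/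
def CrossesFrom (ρ A : ℝ) (N : ℕ) (w : ℕ → ℝ) (i : ℕ) : Prop :=
  ∃ s, i + s ≤ N ∧ A + ρ * (i + s : ℕ) < ∑ j ∈ Finset.range s, w (i + j)

/-- A zero entry does not affect crossing. Starting at `i + 1` the same sums are compared with the
same levels, since the level depends on the absolute time; the empty sum crosses nothing as `0 < A`. -/
lemma crossesFrom_iff_succ {ρ A : ℝ} (hρ : 0 < ρ) (hA : 0 < A) {N : ℕ} {w : ℕ → ℝ} {i : ℕ}
    (h : w i = 0) : CrossesFrom ρ A N w i ↔ CrossesFrom ρ A N w (i + 1) := by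
  constructor
  · rintro ⟨s, hs, hlt⟩
    rcases s with _ | s
    · exfalso
      have : 0 ≤ ρ * ((i + 0 : ℕ) : ℝ) := by positivity
      simp only [Finset.range_zero, Finset.sum_empty] at hlt
      linarith
    · refine ⟨s, by omega, ?_⟩
      rw [Finset.sum_range_succ', add_zero, h, add_zero] at hlt
      convert hlt using 3 <;> (push_cast; ring)
  · rintro ⟨s, hs, hlt⟩
    refine ⟨s + 1, by omega, ?_⟩
    rw [Finset.sum_range_succ', add_zero, h, add_zero]
    convert hlt using 3 <;> (push_cast; ring)

lemma CrossesFrom.lt_posMax {ρ A : ℝ} (hρ : 0 < ρ) {N : ℕ} {w : ℕ → ℝ} {i m : ℕ}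
    (hfar : ∀ l, m ≤ l → i + l < N → w (i + l) = 0) (h : CrossesFrom ρ A N w i) :
    A + ρ * i < posMax m (fun j => w (i + j)) := by
  obtain ⟨s, hs, hlt⟩ := h
  have h0 : A + ρ * i ≤ A + ρ * (i + s : ℕ) := by
    have : 0 ≤ ρ * (s : ℝ) := by positivity
    push_cast; linarith
  rcases le_total s m with hsm | hsm
  · exact lt_posMax_iff.2 ⟨s, hsm, h0.trans_lt hlt⟩
  · refine lt_posMax_iff.2 ⟨m, le_rfl, h0.trans_lt ?_⟩
    rwa [Finset.sum_subset (Finset.range_mono hsm)]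
    intro l hl hl'
    simp only [Finset.mem_range, not_lt] at hl hl'
    exact hfar l hl' (by omega)

lemma crossesFrom_of_lt_posMax {ρ A : ℝ} (hρ : 0 < ρ) {N : ℕ} {w : ℕ → ℝ} {i m : ℕ}
    (hm : i + m ≤ N) (h : A + ρ * (i + m : ℕ) < posMax m (fun j => w (i + j))) :
    CrossesFrom ρ A N w i := by
  obtain ⟨s, hs, hlt⟩ := lt_posMax_iff.1 h
  refine ⟨s, by omega, lt_of_le_of_lt ?_ hlt⟩
  gcongr

open Classical in
/-- A change of the crossing event between the starting times `i` and `i + 1` is decided by the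
cluster `w_i, …, w_{i+k}`, provided no later entry is nonzero. -/
lemma crossesFrom_step {ρ A : ℝ} (hρ : 0 < ρ) {N k i : ℕ} (hi : i + (k + 1) ≤ N)
    (w : ℕ → ℝ) (hfar : ∀ l, k + 1 ≤ l → l ≤ N → w (i + l) = 0) :
    ((if CrossesFrom ρ A N w i then (1 : ℝ) else 0) -
        (if CrossesFrom ρ A N w (i + 1) then (1 : ℝ) else 0) ≤
      (if A + ρ * i < posMax (k + 1) (fun j => w (i + j)) then (1 : ℝ) else 0) -
        (if A + ρ * (k + 1) + ρ * i < posMax k (fun j => w (i + (j + 1))) then (1 : ℝ) else 0)) ∧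
    ((if A + ρ * (k + 1) + ρ * i < posMax (k + 1) (fun j => w (i + j)) then (1 : ℝ) else 0) -
        (if A + ρ * i < posMax k (fun j => w (i + (j + 1))) then (1 : ℝ) else 0) ≤
      (if CrossesFrom ρ A N w i then (1 : ℝ) else 0) -
        (if CrossesFrom ρ A N w (i + 1) then (1 : ℝ) else 0)) := by
  have e : ∀ j, i + (j + 1) = i + 1 + j := fun j => by ring
  have e' : (fun j => w (i + (j + 1))) = fun j => w (i + 1 + j) := funext fun j => by rw [e]
  have hlev : A + ρ * (k + 1) + ρ * i = A + ρ * (i + (k + 1) : ℕ) := by push_cast; ring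
  have hlev' : A + ρ * (k + 1) + ρ * i = A + ρ * (i + 1 + k : ℕ) := by push_cast; ring
  have a1 : CrossesFrom ρ A N w i → A + ρ * i < posMax (k + 1) (fun j => w (i + j)) :=
    CrossesFrom.lt_posMax hρ fun l hl hl' => hfar l hl (by omega)
  have a2 : A + ρ * (k + 1) + ρ * i < posMax (k + 1) (fun j => w (i + j)) →
      CrossesFrom ρ A N w i := fun h => crossesFrom_of_lt_posMax hρ hi (hlev ▸ h)
  have b1 : CrossesFrom ρ A N w (i + 1) → A + ρ * i < posMax k (fun j => w (i + (j + 1))) := by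
    intro h
    rw [e']
    refine lt_of_le_of_lt ?_ (CrossesFrom.lt_posMax (m := k) hρ (fun l hl hl' => ?_) h)
    · push_cast; nlinarith
    · rw [← e]; exact hfar _ (by omega) (by omega)
  have b2 : A + ρ * (k + 1) + ρ * i < posMax k (fun j => w (i + (j + 1))) →
      CrossesFrom ρ A N w (i + 1) := by
    rw [e']
    exact fun h => crossesFrom_of_lt_posMax hρ (by omega) (hlev' ▸ h)
  constructor <;> split_ifs <;> first | (norm_num; done) | (exfalso; tauto)

lemma levelCount_eq_sum_indicator {Ω : Type*} (ρ : ℝ) (n : ℕ) (B : ℝ) (f : Ω → ℝ) (ω : Ω) :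
    levelCount ρ n B (f ω) =
      ∑ i ∈ Finset.range n, Set.indicator {ω | B + ρ * i < f ω} (1 : Ω → ℝ) ω := by
  simp [levelCount, Set.indicator_apply]

section Cluster

variable {Ω : Type*} [MeasurableSpace Ω] {P : Measure Ω} {X : ℤ → Ω → ℝ}

lemma StrictlyStationary.measureReal_shift (hstat : StrictlyStationary P X) (h : ℤ)
    {B : Set (ℤ → ℝ)} (hB : MeasurableSet B) :
    P.real {ω | (fun t => X (t + h) ω) ∈ B} = P.real {ω | (fun t => X t ω) ∈ B} := by
  have := (hstat h).measure_mem_eq hB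
  simp only [measureReal_def]
  exact congrArg _ this

lemma StrictlyStationary.measureReal_exceed (hstat : StrictlyStationary P X) (h : ℤ) (c : ℝ) :
    P.real {ω | c < |X h ω|} = P.real {ω | c < |X 0 ω|} := by
  have := hstat.measureReal_shift h (B := {ξ | c < |ξ 0|})
    (measurableSet_lt measurable_const (measurable_pi_apply _).abs)
  simpa using this

lemma measurable_posMax_cut (c : ℝ) (k : ℕ) (f : ℕ → ℤ) :
    Measurable fun ξ : ℤ → ℝ => posMax k (fun j => cut c (ξ (f j))) :=
  (continuous_posMax k).measurable.comp
    (measurable_pi_iff.2 fun j => (measurable_cut c).comp (measurable_pi_apply (f j)))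

lemma measurableSet_crossesFrom (ρ A : ℝ) (N : ℕ) (i : ℕ) :
    MeasurableSet {w : ℕ → ℝ | CrossesFrom ρ A N w i} := by
  have : {w : ℕ → ℝ | CrossesFrom ρ A N w i} = ⋃ s, {w : ℕ → ℝ | i + s ≤ N ∧
      A + ρ * (i + s : ℕ) < ∑ j ∈ Finset.range s, w (i + j)} := by
    ext w; simp [CrossesFrom]
  rw [this]
  refine MeasurableSet.iUnion fun s => ?_
  have hm : Measurable fun w : ℕ → ℝ => ∑ j ∈ Finset.range s, w (i + j) :=
    Finset.measurable_fun_sum _ fun j _ => measurable_pi_apply _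
  exact (MeasurableSet.const _).inter (measurableSet_lt measurable_const hm)

variable [IsProbabilityMeasure P]

/-- The expected change of the crossing indicator between consecutive starting times, in terms of
the cluster started at an exceedance. Stationarity moves the cluster to the origin. -/
lemma measureReal_crossesFrom_step (hXm : ∀ t, Measurable (X t)) (hstat : StrictlyStationary P X)
    {ρ A c : ℝ} (hρ : 0 < ρ) (hA : 0 < A) {N k i : ℕ} (hi : i + (k + 1) ≤ N) :
    let E : ℕ → Set Ω := fun i => {ω | CrossesFrom ρ A N (fun j => cut c (X ((j : ℤ) + 1) ω)) i}
    let U : ℝ → Set Ω := fun s => {ω | c < |X 0 ω| ∧ s < posMax (k + 1) (fun j => cut c (X j ω))}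
    let V : ℝ → Set Ω :=
      fun s => {ω | c < |X 0 ω| ∧ s < posMax k (fun j => cut c (X ((j + 1 : ℕ) : ℤ) ω))}
    let G : Set Ω := {ω | c < |X 0 ω| ∧ ∃ l : ℕ, k + 1 ≤ l ∧ l ≤ N ∧ c < |X l ω|}
    P.real (E i) - P.real (E (i + 1)) ≤
      P.real (U (A + ρ * i)) - P.real (V (A + ρ * (k + 1) + ρ * i)) + 2 * P.real G ∧
    P.real (U (A + ρ * (k + 1) + ρ * i)) - P.real (V (A + ρ * i)) - 2 * P.real G ≤
      P.real (E i) - P.real (E (i + 1)) := by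
  classical
  intro E U V G
  set h : ℤ := (i : ℤ) + 1 with hh
  let w : Ω → ℕ → ℝ := fun ω j => cut c (X ((j : ℤ) + 1) ω)
  have hcast : ∀ j : ℕ, (((i + j : ℕ) : ℤ) + 1) = (j : ℤ) + h := fun j => by push_cast; ring
  let U' : ℝ → Set Ω := fun s => {ω | c < |X h ω| ∧ s < posMax (k + 1) (fun j => w ω (i + j))}
  let V' : ℝ → Set Ω := fun s => {ω | c < |X h ω| ∧ s < posMax k (fun j => w ω (i + (j + 1)))}
  let G' : Set Ω := {ω | c < |X h ω| ∧ ∃ l : ℕ, k + 1 ≤ l ∧ l ≤ N ∧ c < |X (l + h) ω|}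
  have hmeasX : Measurable fun ω (t : ℤ) => X t ω := measurable_pi_iff.2 hXm
  have hmeasXh : Measurable fun ω (t : ℤ) => X (t + h) ω := measurable_pi_iff.2 fun t => hXm _
  have mF : MeasurableSet {ξ : ℤ → ℝ | c < |ξ 0|} :=
    measurableSet_lt measurable_const (measurable_pi_apply _).abs
  have mUB : ∀ s, MeasurableSet {ξ : ℤ → ℝ | c < |ξ 0| ∧
      s < posMax (k + 1) (fun j => cut c (ξ j))} := fun s =>
    mF.inter (measurableSet_lt measurable_const (measurable_posMax_cut c _ (fun j => j)))
  have mVB : ∀ s, MeasurableSet {ξ : ℤ → ℝ | c < |ξ 0| ∧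
      s < posMax k (fun j => cut c (ξ ((j + 1 : ℕ) : ℤ)))} := fun s =>
    mF.inter (measurableSet_lt measurable_const
      (measurable_posMax_cut c _ (fun j => ((j + 1 : ℕ) : ℤ))))
  have mGB : MeasurableSet {ξ : ℤ → ℝ | c < |ξ 0| ∧
      ∃ l : ℕ, k + 1 ≤ l ∧ l ≤ N ∧ c < |ξ l|} := by
    refine mF.inter ?_
    have : {ξ : ℤ → ℝ | ∃ l : ℕ, k + 1 ≤ l ∧ l ≤ N ∧ c < |ξ l|} =
        ⋃ l : ℕ, {ξ : ℤ → ℝ | k + 1 ≤ l ∧ l ≤ N ∧ c < |ξ l|} := by ext; simp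
    change MeasurableSet {ξ : ℤ → ℝ | ∃ l : ℕ, k + 1 ≤ l ∧ l ≤ N ∧ c < |ξ l|}
    rw [this]
    exact MeasurableSet.iUnion fun l => (MeasurableSet.const _).inter
      ((MeasurableSet.const _).inter (measurableSet_lt measurable_const (measurable_pi_apply _).abs))
  have eU : ∀ s, P.real (U' s) = P.real (U s) := fun s => by
    have := hstat.measureReal_shift h (mUB s)
    simpa only [Set.mem_ofPred_eq, zero_add, U, U', w, hcast] using this
  have eV : ∀ s, P.real (V' s) = P.real (V s) := fun s => by
    have := hstat.measureReal_shift h (mVB s)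
    simpa only [Set.mem_ofPred_eq, zero_add, V, V', w, hcast] using this
  have eG : P.real G' = P.real G := by
    have := hstat.measureReal_shift h mGB
    simpa only [Set.mem_ofPred_eq, zero_add, G, G'] using this
  have mE : ∀ i, MeasurableSet (E i) := fun i => by
    have : Measurable w := measurable_pi_iff.2 fun j => (measurable_cut c).comp (hXm _)
    exact this (measurableSet_crossesFrom ρ A N i)
  have mU : ∀ s, MeasurableSet (U' s) := fun s => by
    have := hmeasXh (mUB s)
    simpa only [Set.preimage, Set.mem_ofPred_eq, zero_add, U', w, hcast] using this
  have mV : ∀ s, MeasurableSet (V' s) := fun s => by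
    have := hmeasXh (mVB s)
    simpa only [Set.preimage, Set.mem_ofPred_eq, zero_add, V', w, hcast] using this
  have mG : MeasurableSet G' := by
    have := hmeasXh mGB
    simpa only [Set.preimage, Set.mem_ofPred_eq, zero_add, G'] using this
  have hint : ∀ {S : Set Ω}, MeasurableSet S → Integrable (S.indicator (1 : Ω → ℝ)) P :=
    fun hS => (integrable_const (1 : ℝ)).indicator hS
  -- the pointwise inequalities between indicator functions
  have key : ∀ ω,
      (E i).indicator (1 : Ω → ℝ) ω - (E (i + 1)).indicator (1 : Ω → ℝ) ω ≤
        (U' (A + ρ * i)).indicator (1 : Ω → ℝ) ω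
          - (V' (A + ρ * (k + 1) + ρ * i)).indicator (1 : Ω → ℝ) ω
          + 2 * G'.indicator (1 : Ω → ℝ) ω ∧
      (U' (A + ρ * (k + 1) + ρ * i)).indicator (1 : Ω → ℝ) ω
          - (V' (A + ρ * i)).indicator (1 : Ω → ℝ) ω - 2 * G'.indicator (1 : Ω → ℝ) ω ≤
        (E i).indicator (1 : Ω → ℝ) ω - (E (i + 1)).indicator (1 : Ω → ℝ) ω := by
    intro ω
    by_cases hF : c < |X h ω|
    · by_cases hG : ω ∈ G'
      · simp only [Set.indicator_of_mem hG, Pi.one_apply]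
        constructor <;> simp only [Set.indicator_apply, Pi.one_apply] <;> split_ifs <;> norm_num
      · have hfar : ∀ l, k + 1 ≤ l → l ≤ N → w ω (i + l) = 0 := by
          intro l hl hl'
          simp only [w, hcast]
          refine cut_eq_zero (not_lt.1 fun hlt => hG ⟨hF, l, hl, hl', hlt⟩)
        have := crossesFrom_step (A := A) hρ hi (w ω) hfar
        simp only [Set.indicator_of_notMem hG, mul_zero, add_zero, sub_zero]
        simpa only [Set.indicator_apply, Pi.one_apply, E, U', V', Set.mem_ofPred_eq, hF, true_and]
          using this
    · have hwi : w ω i = 0 := cut_eq_zero (not_lt.1 hF)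
      have hE : ω ∈ E i ↔ ω ∈ E (i + 1) := crossesFrom_iff_succ hρ hA hwi
      simp only [Set.indicator_apply, U', V', G', Set.mem_ofPred_eq, hF, false_and, if_false, hE]
      norm_num
  have hmu : ∀ {S : Set Ω}, MeasurableSet S → ∫ ω, S.indicator (1 : Ω → ℝ) ω ∂P = P.real S :=
    fun hS => integral_indicator_one hS
  have hint3 : ∀ {S T R : Set Ω}, MeasurableSet S → MeasurableSet T → MeasurableSet R → ∀ r : ℝ,
      Integrable (fun ω => S.indicator (1 : Ω → ℝ) ω - T.indicator (1 : Ω → ℝ) ω +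
        r * R.indicator (1 : Ω → ℝ) ω) P := fun hS hT hR r =>
    ((hint hS).sub (hint hT)).add ((hint hR).const_mul r)
  have hmu3 : ∀ {S T R : Set Ω}, MeasurableSet S → MeasurableSet T → MeasurableSet R → ∀ r : ℝ,
      ∫ ω, (S.indicator (1 : Ω → ℝ) ω - T.indicator (1 : Ω → ℝ) ω +
        r * R.indicator (1 : Ω → ℝ) ω) ∂P = P.real S - P.real T + r * P.real R := by
    intro S T R hS hT hR r
    have h1 : Integrable (fun ω => S.indicator (1 : Ω → ℝ) ω - T.indicator (1 : Ω → ℝ) ω) P :=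
      (hint hS).sub (hint hT)
    rw [integral_add h1 ((hint hR).const_mul r), integral_sub (hint hS) (hint hT),
      integral_const_mul, hmu hS, hmu hT, hmu hR]
  have hE := hmu3 (mE i) (mE (i + 1)) MeasurableSet.univ 0
  have hEi := hint3 (mE i) (mE (i + 1)) MeasurableSet.univ 0
  rw [← eU, ← eU, ← eV, ← eV, ← eG]
  constructor
  · have := integral_mono hEi (hint3 (mU (A + ρ * i)) (mV (A + ρ * (k + 1) + ρ * i)) mG 2)
      fun ω => by linarith [(key ω).1]
    rw [hE, hmu3 (mU _) (mV _) mG] at this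
    linarith
  · have := integral_mono (hint3 (mU (A + ρ * (k + 1) + ρ * i)) (mV (A + ρ * i)) mG (-2)) hEi
      fun ω => by linarith [(key ω).2]
    rw [hE, hmu3 (mU _) (mV _) mG] at this
    linarith

lemma integrable_levelCount (F : Set Ω) {ρ B : ℝ} {n : ℕ} {f : Ω → ℝ} (hf : Measurable f) :
    Integrable (fun ω => levelCount ρ n B (f ω)) (P.restrict F) := by
  simp only [levelCount_eq_sum_indicator]
  exact integrable_finsetSum _ fun i _ =>
    (integrable_const (1 : ℝ)).indicator (measurableSet_lt measurable_const hf)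

lemma setIntegral_levelCount (F : Set Ω) {ρ B : ℝ} {n : ℕ} {f : Ω → ℝ} (hf : Measurable f) :
    ∫ ω in F, levelCount ρ n B (f ω) ∂P =
      ∑ i ∈ Finset.range n, P.real (F ∩ {ω | B + ρ * i < f ω}) := by
  have hm : ∀ i : ℕ, MeasurableSet {ω | B + ρ * i < f ω} := fun i =>
    measurableSet_lt measurable_const hf
  simp only [levelCount_eq_sum_indicator]
  rw [integral_finsetSum (f := fun (i : ℕ) ω => Set.indicator {ω | B + ρ * i < f ω} (1 : Ω → ℝ) ω) _
    fun i _ => (integrable_const (1 : ℝ)).indicator (hm i)]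
  refine Finset.sum_congr rfl fun i _ => ?_
  rw [integral_indicator_one (hm i), measureReal_restrict_apply (hm i), Set.inter_comm]

/-- The crossing probability of the process of large values is, up to a boundary and clustering
error, the expected gain of a cluster started at an exceedance. -/
lemma abs_crossing_sub_gain_le (hXm : ∀ t, Measurable (X t)) (hstat : StrictlyStationary P X)
    {ρ A c : ℝ} (hρ : 0 < ρ) (hA : 0 < A) (n k : ℕ) :
    |P.real {ω | CrossesFrom ρ A (n + k) (fun j => cut c (X ((j : ℤ) + 1) ω)) 0} -
        ∫ ω in {ω | c < |X 0 ω|}, gain ρ n A k (fun j => cut c (X j ω)) ∂P| ≤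
      (2 * k + 3) * P.real {ω | c < |X 0 ω|} + 2 * n *
        P.real {ω | c < |X 0 ω| ∧ ∃ l : ℕ, k + 1 ≤ l ∧ l ≤ n + k ∧ c < |X l ω|} := by
  set F : Set Ω := {ω | c < |X 0 ω|} with hF
  set G : Set Ω := {ω | c < |X 0 ω| ∧ ∃ l : ℕ, k + 1 ≤ l ∧ l ≤ n + k ∧ c < |X l ω|}
  let E : ℕ → Set Ω := fun i =>
    {ω | CrossesFrom ρ A (n + k) (fun j => cut c (X ((j : ℤ) + 1) ω)) i}
  let b : Ω → ℝ := fun ω => posMax (k + 1) (fun j => cut c (X j ω))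
  let b' : Ω → ℝ := fun ω => posMax k (fun j => cut c (X ((j + 1 : ℕ) : ℤ) ω))
  have hmeasX : Measurable fun ω (t : ℤ) => X t ω := measurable_pi_iff.2 hXm
  have mF : MeasurableSet F := measurableSet_lt measurable_const (hXm 0).abs
  have mb : Measurable b := by
    have h := (measurable_posMax_cut c (k + 1) fun j : ℕ => (j : ℤ)).comp hmeasX
    exact h
  have mb' : Measurable b' := by
    have h := (measurable_posMax_cut c k fun j : ℕ => ((j + 1 : ℕ) : ℤ)).comp hmeasX
    exact h
  have hcount : ∀ (B : ℝ) (f : Ω → ℝ), Measurable f →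
      ∑ i ∈ Finset.range n, P.real {ω | c < |X 0 ω| ∧ B + ρ * i < f ω} =
        ∫ ω in F, levelCount ρ n B (f ω) ∂P := fun B f hf => by
    rw [setIntegral_levelCount F hf]
    refine Finset.sum_congr rfl fun i _ => congrArg P.real ?_
    exact Set.ext fun ω => Iff.rfl
  have icount : ∀ (B : ℝ) (f : Ω → ℝ), Measurable f →
      Integrable (fun ω => levelCount ρ n B (f ω)) (P.restrict F) := fun B f hf =>
    integrable_levelCount F hf
  have igain : Integrable (fun ω => gain ρ n A k (fun j => cut c (X j ω))) (P.restrict F) := by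
    refine Integrable.of_bound (C := (n : ℝ)) ?_ ?_
    · exact ((continuous_gain ρ n A k).measurable.comp
        (measurable_pi_iff.2 fun j => (measurable_cut c).comp (hXm _))).aestronglyMeasurable
    · exact ae_of_all _ fun ω => abs_gain_le (Nat.cast_nonneg n) _ _ _ _
  -- telescoping over the starting times
  have htel : P.real (E 0) - P.real (E n) =
      ∑ i ∈ Finset.range n, (P.real (E i) - P.real (E (i + 1))) :=
    (Finset.sum_range_sub' (fun i => P.real (E i)) n).symm
  have hstep := fun i (hi : i ∈ Finset.range n) => measureReal_crossesFrom_step (P := P) hXm hstat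
    hρ hA (c := c) (N := n + k) (k := k) (i := i) (by have := Finset.mem_range.1 hi; omega)
  have hup := Finset.sum_le_sum fun i hi => (hstep i hi).1
  have hlo := Finset.sum_le_sum fun i hi => (hstep i hi).2
  change ∑ i ∈ Finset.range n, (P.real (E i) - P.real (E (i + 1))) ≤ _ at hup
  change _ ≤ ∑ i ∈ Finset.range n, (P.real (E i) - P.real (E (i + 1))) at hlo
  rw [← htel, Finset.sum_add_distrib, Finset.sum_sub_distrib, hcount A b mb,
    hcount (A + ρ * (k + 1)) b' mb', Finset.sum_const, Finset.card_range, nsmul_eq_mul] at hup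
  rw [← htel, Finset.sum_sub_distrib, Finset.sum_sub_distrib, hcount (A + ρ * (k + 1)) b mb,
    hcount A b' mb', Finset.sum_const, Finset.card_range, nsmul_eq_mul] at hlo
  rw [← integral_sub (icount _ _ mb) (icount _ _ mb')] at hup hlo
  have hlc : ∀ x, |levelCount ρ n A x - ramp ρ n A x| ≤ 1 ∧
      |levelCount ρ n (A + ρ * (k + 1)) x - ramp ρ n A x| ≤ k + 2 := by
    intro x
    refine ⟨abs_levelCount_sub_ramp_le hρ n A x, ?_⟩
    refine (abs_sub_le _ (ramp ρ n (A + ρ * (k + 1)) x) _).trans ?_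
    have h1 := abs_levelCount_sub_ramp_le hρ n (A + ρ * (k + 1)) x
    have h2 := abs_ramp_sub_le hρ n (A + ρ * (k + 1)) A x x
    have h3 : |x - (A + ρ * (k + 1)) - (x - A)| / ρ = k + 1 := by
      have hk : (0 : ℝ) < k + 1 := by positivity
      rw [show x - (A + ρ * (k + 1)) - (x - A) = -(ρ * (k + 1)) by ring, abs_neg,
        abs_of_pos (mul_pos hρ hk), mul_div_cancel_left₀ _ hρ.ne']
    linarith
  have hcF : ∫ _ω in F, ((k : ℝ) + 3) ∂P = (k + 3) * P.real F := by
    rw [setIntegral_const, smul_eq_mul, mul_comm]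
  have hup' : ∫ ω in F, (levelCount ρ n A (b ω) - levelCount ρ n (A + ρ * (k + 1)) (b' ω)) ∂P ≤
      ∫ ω in F, gain ρ n A k (fun j => cut c (X j ω)) ∂P + (k + 3) * P.real F := by
    rw [← hcF, ← integral_add igain (integrable_const _)]
    refine integral_mono ((icount _ _ mb).sub (icount _ _ mb'))
      (igain.add (integrable_const _)) fun ω => ?_
    have h1 := abs_le.1 (hlc (b ω)).1
    have h2 := abs_le.1 (hlc (b' ω)).2
    simp only [gain]
    change _ ≤ ramp ρ n A (b ω) - ramp ρ n A (b' ω) + _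
    linarith [h1.2, h2.1]
  have hlo' : ∫ ω in F, gain ρ n A k (fun j => cut c (X j ω)) ∂P - (k + 3) * P.real F ≤
      ∫ ω in F, (levelCount ρ n (A + ρ * (k + 1)) (b ω) - levelCount ρ n A (b' ω)) ∂P := by
    rw [← hcF, ← integral_sub igain (integrable_const _)]
    refine integral_mono (igain.sub (integrable_const _))
      ((icount _ _ mb).sub (icount _ _ mb')) fun ω => ?_
    have h1 := abs_le.1 (hlc (b ω)).2
    have h2 := abs_le.1 (hlc (b' ω)).1
    simp only [gain]
    change ramp ρ n A (b ω) - ramp ρ n A (b' ω) - _ ≤ _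
    linarith [h1.1, h2.2]
  -- crossing from a start in the last `k` steps needs an exceedance there
  have hEn : P.real (E n) ≤ k * P.real F := by
    have hsub : E n ⊆ ⋃ j ∈ Finset.range k, {ω | c < |X (((n + j : ℕ) : ℤ) + 1) ω|} := by
      rintro ω ⟨s, hs, hlt⟩
      by_contra hcon
      simp only [Set.mem_iUnion, Finset.mem_range, Set.mem_ofPred_eq, not_exists, not_lt] at hcon
      rw [Finset.sum_eq_zero fun j hj => cut_eq_zero
        (hcon j (by have := Finset.mem_range.1 hj; omega))] at hlt
      have : 0 ≤ ρ * ((n + s : ℕ) : ℝ) := by positivity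
      linarith
    calc P.real (E n) ≤ P.real (⋃ j ∈ Finset.range k, {ω | c < |X (((n + j : ℕ) : ℤ) + 1) ω|}) :=
          measureReal_mono hsub (measure_ne_top _ _)
      _ ≤ ∑ j ∈ Finset.range k, P.real {ω | c < |X (((n + j : ℕ) : ℤ) + 1) ω|} :=
          measureReal_biUnion_finset_le _ _
      _ = k * P.real F := by
          simp only [hstat.measureReal_exceed, Finset.sum_const, Finset.card_range, nsmul_eq_mul]
          rfl
  have hEn0 : 0 ≤ P.real (E n) := measureReal_nonneg
  have hF0 : 0 ≤ P.real F := measureReal_nonneg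
  have hkF : 0 ≤ k * P.real F := by positivity
  change |P.real (E 0) - _| ≤ _
  rw [abs_le]
  constructor
  · change _ ≤ _ at hlo
    have : ∫ ω in F, (levelCount ρ n (A + ρ * (k + 1)) (b ω) - levelCount ρ n A (b' ω)) ∂P -
      n * (2 * P.real G) ≤ P.real (E 0) - P.real (E n) := hlo
    linarith
  · have : P.real (E 0) - P.real (E n) ≤ ∫ ω in F, (levelCount ρ n A (b ω) -
      levelCount ρ n (A + ρ * (k + 1)) (b' ω)) ∂P + n * (2 * P.real G) := hup
    linarith

end Cluster

/-! ### Regular variation of the marginal tail and the two conditions in usable form -/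

lemma partialSum_eq_sum_range {Ω : Type*} (X : ℤ → Ω → ℝ) (t : ℕ) (ω : Ω) :
    partialSum X t ω = ∑ j ∈ Finset.range t, X ((j : ℤ) + 1) ω := by
  unfold partialSum
  induction t with
  | zero => simp
  | succ t ih => rw [Finset.sum_Icc_succ_top (by omega), Finset.sum_range_succ, ih]; push_cast; rfl

/-- Splitting of the random walk into its small and its large increments. -/
lemma partialSum_eq_trunc_add_cut {Ω : Type*} (X : ℤ → Ω → ℝ) (c : ℝ) (t : ℕ) (ω : Ω) :
    partialSum X t ω = partialSum (trunc c X) t ω +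
      ∑ j ∈ Finset.range t, cut c (X ((j : ℤ) + 1) ω) := by
  rw [partialSum_eq_sum_range, partialSum_eq_sum_range, ← Finset.sum_add_distrib]
  refine Finset.sum_congr rfl fun j _ => ?_
  unfold trunc cut
  split_ifs <;> linarith

section Tail

variable {Ω : Type*} [MeasurableSpace Ω] {P : Measure Ω} {X : ℤ → Ω → ℝ} {α : ℝ}

/-- The marginal tail `x ↦ P(|X_0| > x)`. -/
def absTail {Ω : Type*} [MeasurableSpace Ω] (P : Measure Ω) (X : ℤ → Ω → ℝ) (x : ℝ) : ℝ :=
  P.real {ω | x < |X 0 ω|}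

lemma absTail_regularVariation (hstat : StrictlyStationary P X) (hRV : RegularlyVaryingSeq P α X)
    {u : ℝ} (hu : 0 < u) :
    Tendsto (fun x => absTail P X (u * x) / absTail P X x) atTop (𝓝 (u ^ (-α))) := by
  obtain ⟨σ, hσ, -, h⟩ := hRV 1 le_rfl
  have := h u hu (BoundedContinuousFunction.const _ 1)
  have hnorm : ∀ ω, ‖(WithLp.toLp 2 (fun i : Fin 1 => X (((i : ℕ) : ℤ) + 1) ω) :
      EuclideanSpace ℝ (Fin 1))‖ = |X 1 ω| := by
    intro ω
    rw [EuclideanSpace.norm_eq]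
    simp [Real.sqrt_sq_eq_abs]
  simp only [hnorm, BoundedContinuousFunction.const_apply, integral_const, smul_eq_mul, mul_one,
    measureReal_restrict_apply_univ, probReal_univ] at this
  simp only [hstat.measureReal_exceed] at this
  exact this

variable [IsProbabilityMeasure P]

lemma absTail_anti : Antitone (absTail P X) := fun _ _ h =>
  measureReal_mono (fun _ hω => lt_of_le_of_lt h hω) (measure_ne_top _ _)

lemma absTail_pos (hstat : StrictlyStationary P X) (hRV : RegularlyVaryingSeq P α X) (x : ℝ) :
    0 < absTail P X x := by
  have h := absTail_regularVariation hstat hRV one_pos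
  rw [Real.one_rpow] at h
  have h1 := (h.eventually (lt_mem_nhds (show (0 : ℝ) < 1 by norm_num))).and
    (eventually_ge_atTop x)
  obtain ⟨y, hy, hxy⟩ := h1.exists
  refine lt_of_lt_of_le ?_ (absTail_anti hxy)
  rcases (measureReal_nonneg : 0 ≤ absTail P X y).eq_or_lt with h0 | h0
  · rw [show absTail P X y = 0 from h0.symm, div_zero] at hy; exact absurd hy (lt_irrefl _)
  · exact h0

/-- The vanishing-small-values condition with the limits unfolded. -/
lemma VanishingSmallValues.exists_bound {C₁ C₂ : ℝ}
    (hV : VanishingSmallValues P X (fun n => Set.Icc (C₁ * n) (C₂ * n))) (hC : 0 < C₁)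
    (hpos : ∀ x, 0 < absTail P X x)
    {δ η : ℝ} (hδ : 0 < δ) (hη : 0 < η) :
    ∀ᶠ ε in 𝓝[>] (0 : ℝ), ∀ᶠ n : ℕ in atTop, ∀ x ∈ Set.Icc (C₁ * n) (C₂ * n),
      P.real {ω | ∃ t ≤ n, δ * x < |partialSum (trunc (ε * x) X) t ω|} ≤
        η * n * absTail P X x := by
  have h := (hV δ hδ).eventually (gt_mem_nhds (show (0 : ℝ≥0∞) < ENNReal.ofReal η by simpa))
  filter_upwards [h] with ε hε
  filter_upwards [eventually_lt_of_limsup_lt hε, eventually_gt_atTop 0] with n hn hn0 x hx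
  have hn' : (0 : ℝ) < n := by exact_mod_cast hn0
  have hx0 : 0 < x := (mul_pos hC hn').trans_le hx.1
  have h1 := (le_iSup₂ (f := fun x (_ : x ∈ Set.Icc (C₁ * (n : ℝ)) (C₂ * n)) =>
    P {ω | δ < x⁻¹ * ⨆ t : Set.Iic n, |partialSum (trunc (ε * x) X) t ω|} /
      ((n : ℝ≥0∞) * P {ω | x < |X 0 ω|})) x hx).trans hn.le
  have hp : P {ω | x < |X 0 ω|} ≠ 0 := by
    intro h0
    have := hpos x
    simp [absTail, measureReal_def, h0] at this
  rw [ENNReal.div_le_iff (by simp [hp, hn0.ne']) (by finiteness)] at h1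
  have h2 : P {ω | ∃ t ≤ n, δ * x < |partialSum (trunc (ε * x) X) t ω|} ≤
      ENNReal.ofReal η * (n * P {ω | x < |X 0 ω|}) := by
    refine (measure_mono ?_).trans h1
    rintro ω ⟨t, ht, hlt⟩
    change δ < x⁻¹ * _
    rw [inv_mul_eq_div, lt_div_iff₀ hx0]
    exact hlt.trans_le (le_ciSup (f := fun t : Set.Iic n => |partialSum (trunc (ε * x) X) t ω|)
      (Set.finite_range _).bddAbove ⟨t, ht⟩)
  have h3 := ENNReal.toReal_mono (by finiteness) h2
  rw [ENNReal.toReal_mul, ENNReal.toReal_mul, ENNReal.toReal_ofReal hη.le, ENNReal.toReal_natCast,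
    ← mul_assoc] at h3
  exact h3

/-- The anti-clustering condition with the limits unfolded. -/
lemma AntiClustering.exists_bound (hXm : ∀ t, Measurable (X t)) {C₁ C₂ : ℝ}
    (hA : AntiClustering P X (fun n => Set.Icc (C₁ * n) (C₂ * n)))
    {δ η : ℝ} (hδ : 0 < δ) (hη : 0 < η) :
    ∀ᶠ k : ℕ in atTop, ∀ᶠ n : ℕ in atTop, ∀ x ∈ Set.Icc (C₁ * n) (C₂ * n),
      P.real {ω | δ * x < |X 0 ω| ∧ ∃ l : ℕ, k ≤ l ∧ l ≤ n ∧ δ * x < |X l ω|} ≤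
        η * absTail P X (δ * x) := by
  have h := (hA δ hδ).eventually (gt_mem_nhds (show (0 : ℝ≥0∞) < ENNReal.ofReal η by simpa))
  filter_upwards [h] with k hk
  filter_upwards [eventually_lt_of_limsup_lt hk] with n hn x hx
  have h1 := (le_iSup₂ (f := fun x (_ : x ∈ Set.Icc (C₁ * (n : ℝ)) (C₂ * n)) =>
    (P[|{ω | x * δ < |X 0 ω|}]) {ω | x * δ < maxAbs X k n ω}) x hx).trans hn.le
  have mF : MeasurableSet {ω | x * δ < |X 0 ω|} := measurableSet_lt measurable_const (hXm 0).abs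
  rw [cond_apply mF] at h1
  have h2 : P {ω | δ * x < |X 0 ω| ∧ ∃ l : ℕ, k ≤ l ∧ l ≤ n ∧ δ * x < |X l ω|} ≤
      ENNReal.ofReal η * P {ω | δ * x < |X 0 ω|} := by
    have hsub : {ω | δ * x < |X 0 ω| ∧ ∃ l : ℕ, k ≤ l ∧ l ≤ n ∧ δ * x < |X l ω|} ⊆
        {ω | x * δ < |X 0 ω|} ∩ {ω | x * δ < maxAbs X k n ω} := by
      rintro ω ⟨h0, l, hl, hl', hlt⟩
      refine ⟨by simpa only [Set.mem_ofPred_eq, mul_comm x] using h0, ?_⟩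
      simp only [Set.mem_ofPred_eq, mul_comm x]
      exact hlt.trans_le (le_ciSup (f := fun i : Set.Icc k n => |X ((i : ℕ) : ℤ) ω|)
        (Set.finite_range _).bddAbove ⟨l, hl, hl'⟩)
    refine (measure_mono hsub).trans ?_
    simp only [mul_comm δ]
    by_cases h0 : P {ω | x * δ < |X 0 ω|} = 0
    · exact (measure_mono_null Set.inter_subset_left h0).trans_le zero_le
    · rwa [← ENNReal.div_eq_inv_mul, ENNReal.div_le_iff h0 (by finiteness)] at h1
  have h3 := ENNReal.toReal_mono (by finiteness) h2
  rw [ENNReal.toReal_mul, ENNReal.toReal_ofReal hη.le] at h3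
  exact h3

lemma measureReal_exists_exceed_le (hstat : StrictlyStationary P X) (n : ℕ) (c : ℝ) :
    P.real {ω | ∃ j < n, c < |X ((j : ℤ) + 1) ω|} ≤ n * absTail P X c := by
  have hsub : {ω | ∃ j < n, c < |X ((j : ℤ) + 1) ω|} ⊆
      ⋃ j ∈ Finset.range n, {ω | c < |X ((j : ℤ) + 1) ω|} := by
    rintro ω ⟨j, hj, h⟩
    simp only [Set.mem_iUnion, Finset.mem_range]
    exact ⟨j, hj, h⟩
  refine (measureReal_mono hsub (measure_ne_top _ _)).trans ?_
  refine (measureReal_biUnion_finset_le _ _).trans ?_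
  simp only [hstat.measureReal_exceed, Finset.sum_const, Finset.card_range, nsmul_eq_mul]
  exact le_rfl

/-- A bound for large deviations of the maximal partial sum at a linear level: either some increment
exceeds `ε m`, or the truncated sums, which are the sums themselves, are controlled by the
vanishing-small-values condition. -/
lemma exists_measureReal_maximal_le (hstat : StrictlyStationary P X)
    (hRV : RegularlyVaryingSeq P α X)
    (hV : VanishingSmallValues P X (fun n => Set.Icc ((1 / 2 : ℝ) * n) (2 * n)))
    {ρ : ℝ} (hρ : 0 < ρ) :
    ∃ C : ℝ, 0 < C ∧ ∀ᶠ m : ℕ in atTop,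
      P.real {ω | ∃ t ≤ m, ρ * m < |partialSum X t ω|} ≤ C * (m * absTail P X m) := by
  have hpos := absTail_pos (P := P) hstat hRV
  have h1 := hV.exists_bound (by norm_num) hpos hρ one_pos
  obtain ⟨ε, hε, hε0⟩ := (h1.and self_mem_nhdsWithin).exists
  have hε0 : 0 < ε := hε0
  have h2 := (absTail_regularVariation hstat hRV hε0).comp tendsto_natCast_atTop_atTop
  have h3 := h2.eventually (gt_mem_nhds (lt_add_one _))
  refine ⟨1 + (ε ^ (-α) + 1), by positivity, ?_⟩
  filter_upwards [hε, h3] with m hm hm'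
  have hmem : (m : ℝ) ∈ Set.Icc ((1 / 2 : ℝ) * m) (2 * m) := by
    constructor <;> linarith [(Nat.cast_nonneg m : (0 : ℝ) ≤ m)]
  have hm1 := hm m hmem
  have hm2 : absTail P X (ε * m) ≤ (ε ^ (-α) + 1) * absTail P X m :=
    ((div_lt_iff₀ (hpos _)).1 hm').le
  have hsub : {ω | ∃ t ≤ m, ρ * m < |partialSum X t ω|} ⊆
      {ω | ∃ t ≤ m, ρ * m < |partialSum (trunc (ε * m) X) t ω|} ∪
        {ω | ∃ j < m, ε * m < |X ((j : ℤ) + 1) ω|} := by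
    rintro ω ⟨t, ht, hlt⟩
    by_cases hex : ∃ j < m, ε * m < |X ((j : ℤ) + 1) ω|
    · exact Or.inr hex
    · refine Or.inl ⟨t, ht, ?_⟩
      rwa [partialSum_eq_trunc_add_cut X (ε * m), Finset.sum_eq_zero, add_zero] at hlt
      intro j hj
      refine cut_eq_zero (not_lt.1 fun h => hex ⟨j, ?_, h⟩)
      exact (Finset.mem_range.1 hj).trans_le ht
  calc _ ≤ _ := measureReal_mono hsub (measure_ne_top _ _)
    _ ≤ _ := measureReal_union_le _ _
    _ ≤ 1 * m * absTail P X m + m * ((ε ^ (-α) + 1) * absTail P X m) := by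
        refine add_le_add hm1 ((measureReal_exists_exceed_le hstat m _).trans ?_)
        gcongr
    _ = _ := by ring

/-- Crossing the level after the time `N` has probability of order `N P(|X_0| > N)`: sum the
maximal bound over dyadic blocks; the bounds decay geometrically since `α > 1`. -/
lemma exists_measureReal_late_crossing_le (hα : 1 < α) (hstat : StrictlyStationary P X)
    (hRV : RegularlyVaryingSeq P α X)
    (hV : VanishingSmallValues P X (fun n => Set.Icc ((1 / 2 : ℝ) * n) (2 * n)))
    {ρ : ℝ} (hρ : 0 < ρ) :
    ∃ C : ℝ, 0 < C ∧ ∀ᶠ N : ℕ in atTop, ∀ x : ℝ, 0 ≤ x →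
      P.real {ω | ∃ t > N, x < partialSum X t ω - ρ * t} ≤ C * (N * absTail P X N) := by
  have hpos := absTail_pos (P := P) hstat hRV
  obtain ⟨C, hC, hmax⟩ := exists_measureReal_maximal_le hstat hRV hV (half_pos hρ)
  have h2 : (2 : ℝ) * 2 ^ (-α) < 1 := by
    have : (2 : ℝ) * 2 ^ (-α) = 2 ^ (1 - α) := by
      rw [sub_eq_add_neg, Real.rpow_add two_pos, Real.rpow_one]
    rw [this]
    exact Real.rpow_lt_one_of_one_lt_of_neg one_lt_two (by linarith)
  obtain ⟨q, hq1, hq2⟩ := exists_between h2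
  have hq0 : 0 < q := lt_trans (by positivity) hq1
  have h3 := ((absTail_regularVariation (P := P) hstat hRV two_pos).const_mul 2).comp
    tendsto_natCast_atTop_atTop
  have h4 := h3.eventually (gt_mem_nhds hq1)
  obtain ⟨N₀, hN₀⟩ := eventually_atTop.1 (hmax.and (h4.and (eventually_gt_atTop 0)))
  have hgeo : ∀ N ≥ N₀, ∀ j : ℕ, ((2 ^ j * N : ℕ) : ℝ) * absTail P X ((2 ^ j * N : ℕ) : ℝ) ≤
      q ^ j * (N * absTail P X N) := by
    intro N hN j
    induction j with
    | zero => simp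
    | succ j ih =>
      have hge : N₀ ≤ 2 ^ j * N := hN.trans (Nat.le_mul_of_pos_left _ (by positivity))
      have h5 := (hN₀ _ hge).2.1
      simp only [Function.comp_apply] at h5
      rw [← mul_div_assoc, div_lt_iff₀ (hpos _)] at h5
      set y : ℝ := ((2 ^ j * N : ℕ) : ℝ) with hy
      have e : ((2 ^ (j + 1) * N : ℕ) : ℝ) = 2 * y := by rw [hy]; push_cast; ring
      rw [e]
      have hy0 : 0 ≤ y := Nat.cast_nonneg _
      calc 2 * y * absTail P X (2 * y) = y * (2 * absTail P X (2 * y)) := by ring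
        _ ≤ y * (q * absTail P X y) := by gcongr
        _ = q * (y * absTail P X y) := by ring
        _ ≤ q * (q ^ j * (N * absTail P X N)) := by gcongr
        _ = _ := by ring
  refine ⟨C / (1 - q), div_pos hC (by linarith), ?_⟩
  filter_upwards [eventually_ge_atTop N₀] with N hN x hx
  have hN0 : 0 < N := (hN₀ N hN).2.2
  set A : ℕ → Set Ω := fun j =>
    {ω | ∃ t ≤ 2 ^ j * N, ρ / 2 * ((2 ^ j * N : ℕ) : ℝ) < |partialSum X t ω|} with hA
  have hsub : {ω | ∃ t > N, x < partialSum X t ω - ρ * t} ⊆ ⋃ j, A j := by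
    rintro ω ⟨t, ht, hlt⟩
    have hex : ∃ j, t ≤ 2 ^ j * N :=
      ⟨t, t.lt_two_pow_self.le.trans (Nat.le_mul_of_pos_right _ hN0)⟩
    classical
    have hj0 : Nat.find hex ≠ 0 := by
      intro h0
      have := Nat.find_spec hex
      rw [h0] at this
      omega
    obtain ⟨j, hj⟩ := Nat.exists_eq_succ_of_ne_zero hj0
    have hj1 : t ≤ 2 ^ (j + 1) * N := by
      have := Nat.find_spec hex
      rwa [hj] at this
    have hj2 : ¬ t ≤ 2 ^ j * N := Nat.find_min hex (by omega)
    refine Set.mem_iUnion.2 ⟨j + 1, t, hj1, ?_⟩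
    have h6 : ((2 ^ j * N : ℕ) : ℝ) ≤ t := by exact_mod_cast (not_le.1 hj2).le
    have e : ρ / 2 * ((2 ^ (j + 1) * N : ℕ) : ℝ) = ρ * ((2 ^ j * N : ℕ) : ℝ) := by
      push_cast; ring
    rw [e]
    have : ρ * ((2 ^ j * N : ℕ) : ℝ) ≤ ρ * t := by gcongr
    exact lt_of_lt_of_le (by linarith) (le_abs_self _)
  set D : ℝ := N * absTail P X N with hD
  have hD0 : 0 ≤ D := mul_nonneg (Nat.cast_nonneg _) (hpos _).le
  have hAj : ∀ j, P (A j) ≤ ENNReal.ofReal (C * D * q ^ j) := by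
    intro j
    have hge : N₀ ≤ 2 ^ j * N := hN.trans (Nat.le_mul_of_pos_left _ (by positivity))
    rw [← ofReal_measureReal]
    refine ENNReal.ofReal_le_ofReal (((hN₀ _ hge).1).trans ?_)
    rw [mul_assoc, mul_comm D]
    exact mul_le_mul_of_nonneg_left (hgeo N hN j) hC.le
  have hsum : Summable fun j : ℕ => C * D * q ^ j :=
    (summable_geometric_of_lt_one hq0.le hq2).mul_left _
  have htot : P {ω | ∃ t > N, x < partialSum X t ω - ρ * t} ≤
      ENNReal.ofReal (C * D * (1 - q)⁻¹) := by
    calc _ ≤ P (⋃ j, A j) := measure_mono hsub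
      _ ≤ ∑' j, P (A j) := measure_iUnion_le _
      _ ≤ ∑' j, ENNReal.ofReal (C * D * q ^ j) := ENNReal.tsum_le_tsum hAj
      _ = ENNReal.ofReal (∑' j, C * D * q ^ j) :=
          (ENNReal.ofReal_tsum_of_nonneg (fun j => by positivity) hsum).symm
      _ = _ := by rw [tsum_mul_left, tsum_geometric_of_lt_one hq0.le hq2]
  have h1q : 0 < 1 - q := by linarith
  have := ENNReal.toReal_mono (by finiteness) htot
  rw [ENNReal.toReal_ofReal (by positivity)] at this
  calc _ ≤ _ := this
    _ = _ := by rw [div_eq_mul_inv]; ring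

end Tail

/-! ### Weak convergence tested on functions continuous off a null set -/

/-- If `g` is bounded and continuous off a closed null set of the limit, then the integrals of `g`
converge. The function is multiplied by `1 - χ`, where `χ` is a thickened indicator of the closed
set; the product is continuous and the error is controlled by the integrals of `χ`. -/
lemma tendsto_integral_of_continuousOn_compl {E ι : Type*} [PseudoMetricSpace E]
    [MeasurableSpace E] [BorelSpace E] {l : Filter ι} {μs : ι → Measure E}
    [∀ i, IsFiniteMeasure (μs i)] {μ : Measure E} [IsFiniteMeasure μ]
    (h : ∀ f : E →ᵇ ℝ, Tendsto (fun i => ∫ y, f y ∂(μs i)) l (𝓝 (∫ y, f y ∂μ)))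
    {D : Set E} (hD : IsClosed D) (hμD : μ D = 0) {g : E → ℝ} (hg : Measurable g) {C : ℝ}
    (hC : ∀ y, |g y| ≤ C) (hcont : ContinuousOn g Dᶜ) :
    Tendsto (fun i => ∫ y, g y ∂(μs i)) l (𝓝 (∫ y, g y ∂μ)) := by
  rcases isEmpty_or_nonempty E with hE | ⟨⟨y₀⟩⟩
  · have h0 := h 0
    have e : ∀ ν : Measure E, ∫ y, g y ∂ν = ∫ y, (0 : E →ᵇ ℝ) y ∂ν := fun ν =>
      integral_congr_ae (ae_of_all _ fun y => (hE.false y).elim)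
    simpa only [e] using h0
  have hC0 : 0 ≤ C := (abs_nonneg _).trans (hC y₀)
  rw [Metric.tendsto_nhds]
  intro κ hκ
  set δs : ℕ → ℝ := fun n => 1 / ((n : ℝ) + 1)
  have δpos : ∀ n, 0 < δs n := fun n => by positivity
  have hχ := tendsto_integral_thickenedIndicator_of_isClosed μ hD δpos
    tendsto_one_div_add_atTop_nhds_zero_nat
  rw [measureReal_def, hμD, ENNReal.toReal_zero] at hχ
  have hχ' := (hχ.const_mul C).eventually
    (gt_mem_nhds (show C * 0 < κ / 4 by rw [mul_zero]; positivity))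
  obtain ⟨n, hn⟩ := hχ'.exists
  set χ : E → ℝ := fun y => (thickenedIndicator (δpos n) D y : ℝ) with hχdef
  have χcont : Continuous χ := NNReal.continuous_coe.comp (thickenedIndicator (δpos n) D).continuous
  have χ0 : ∀ y, 0 ≤ χ y := fun y => NNReal.coe_nonneg _
  have χ1 : ∀ y, χ y ≤ 1 := fun y => by
    exact_mod_cast thickenedIndicator_le_one (δpos n) D y
  have χD : ∀ y ∈ D, χ y = 1 := fun y hy => by
    simp only [hχdef, thickenedIndicator_one (δpos n) D hy, NNReal.coe_one]
  have gcont : Continuous fun y => g y * (1 - χ y) := by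
    rw [continuous_iff_continuousAt]
    intro y
    by_cases hy : y ∈ D
    · have h1 : Tendsto (fun z => C * (1 - χ z)) (𝓝 y) (𝓝 0) := by
        have : Tendsto (fun z => C * (1 - χ z)) (𝓝 y) (𝓝 (C * (1 - χ y))) :=
          (continuous_const.mul (continuous_const.sub χcont)).continuousAt
        rwa [χD y hy, sub_self, mul_zero] at this
      rw [ContinuousAt, χD y hy, sub_self, mul_zero]
      refine squeeze_zero_norm (fun z => ?_) h1
      rw [Real.norm_eq_abs, abs_mul, abs_of_nonneg (sub_nonneg.2 (χ1 z))]
      exact mul_le_mul_of_nonneg_right (hC z) (sub_nonneg.2 (χ1 z))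
    · exact ((hcont.continuousAt (hD.isOpen_compl.mem_nhds hy))).mul
        (continuous_const.sub χcont).continuousAt
  have gbound : ∀ y, ‖g y * (1 - χ y)‖ ≤ C := fun y => by
    rw [Real.norm_eq_abs, abs_mul, abs_of_nonneg (sub_nonneg.2 (χ1 y))]
    calc |g y| * (1 - χ y) ≤ C * 1 :=
          mul_le_mul (hC y) (by linarith [χ0 y]) (sub_nonneg.2 (χ1 y)) hC0
      _ = C := mul_one C
  have h1 := h (BoundedContinuousFunction.ofNormedAddCommGroup _ gcont C gbound)
  have h2 := h (BoundedContinuousFunction.ofNormedAddCommGroup χ χcont 1 fun y => by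
    rw [Real.norm_eq_abs, abs_of_nonneg (χ0 y)]; exact χ1 y)
  simp only [BoundedContinuousFunction.coe_ofNormedAddCommGroup] at h1 h2
  have herr : ∀ ν : Measure E, IsFiniteMeasure ν →
      |∫ y, g y ∂ν - ∫ y, g y * (1 - χ y) ∂ν| ≤ C * ∫ y, χ y ∂ν := by
    intro ν _
    have ig : Integrable g ν := Integrable.of_bound hg.aestronglyMeasurable C (ae_of_all _ hC)
    have ig' : Integrable (fun y => g y * (1 - χ y)) ν :=
      Integrable.of_bound gcont.aestronglyMeasurable C (ae_of_all _ gbound)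
    have iχ : Integrable χ ν := Integrable.of_bound χcont.aestronglyMeasurable 1
      (ae_of_all _ fun y => by rw [Real.norm_eq_abs, abs_of_nonneg (χ0 y)]; exact χ1 y)
    rw [← integral_sub ig ig', ← integral_const_mul]
    refine abs_integral_le_integral_abs.trans ?_
    refine integral_mono (ig.sub ig').abs (iχ.const_mul C) fun y => ?_
    have : g y - g y * (1 - χ y) = g y * χ y := by ring
    change |g y - g y * (1 - χ y)| ≤ C * χ y
    rw [this, abs_mul, abs_of_nonneg (χ0 y)]
    exact mul_le_mul_of_nonneg_right (hC y) (χ0 y)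
  have hlim := (h2.const_mul C).eventually (gt_mem_nhds hn)
  filter_upwards [hlim, Metric.tendsto_nhds.1 h1 (κ / 4) (by positivity)] with i hi hi'
  have e1 := herr (μs i) inferInstance
  have e2 := herr μ inferInstance
  rw [Real.dist_eq] at hi' ⊢
  rw [abs_lt] at hi' ⊢
  rw [abs_le] at e1 e2
  constructor <;> linarith [e1.1, e1.2, e2.1, e2.2, hi'.1, hi'.2]

/-! ### The polar decomposition of the tail process -/

/-- The measure `α r ^ (-α - 1) dr` on `(0, ∞)`; it gives mass `c ^ (-α)` to `(c, ∞)`. -/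
def powerMeasure (α : ℝ) : Measure ℝ :=
  (volume.restrict (Set.Ioi 0)).withDensity fun r => ENNReal.ofReal (α * r ^ (-α - 1))

lemma powerMeasure_Ioi {α : ℝ} (hα : 0 < α) {c : ℝ} (hc : 0 < c) :
    powerMeasure α (Set.Ioi c) = ENNReal.ofReal (c ^ (-α)) := by
  unfold powerMeasure
  rw [withDensity_apply _ measurableSet_Ioi, Measure.restrict_restrict measurableSet_Ioi,
    Set.inter_eq_left.2 (Set.Ioi_subset_Ioi hc.le),
    ← ofReal_integral_eq_lintegral_ofReal]
  · rw [integral_const_mul, integral_Ioi_rpow_of_lt (by linarith) hc]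
    congr 1
    have : -α - 1 + 1 = -α := by ring
    rw [this]
    field_simp
  · exact (integrableOn_Ioi_rpow_of_lt (by linarith) hc).const_mul α
  · refine (ae_restrict_iff' measurableSet_Ioi).2 (ae_of_all _ fun r hr => ?_)
    have : 0 < r := hc.trans hr
    simp only [Pi.zero_apply]; positivity

instance (α : ℝ) : NullSingletonClass (powerMeasure α) := by
  unfold powerMeasure; infer_instance

instance (α : ℝ) : SFinite (powerMeasure α) := by
  unfold powerMeasure; infer_instance

lemma isFiniteMeasure_powerMeasure_restrict {α : ℝ} (hα : 0 < α) {c : ℝ} (hc : 0 < c) :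
    IsFiniteMeasure ((powerMeasure α).restrict (Set.Ioi c)) :=
  ⟨by rw [Measure.restrict_apply_univ, powerMeasure_Ioi hα hc]; exact ENNReal.ofReal_lt_top⟩

section Tail

variable {Ω Ω' : Type*} [MeasurableSpace Ω] [MeasurableSpace Ω']
  {P : Measure Ω} {Q : Measure Ω'}
  {X : ℤ → Ω → ℝ} {Y : ℤ → Ω' → ℝ} {α : ℝ}

lemma IsTailProcess.measurable_spectralTail (hY : IsTailProcess P α X Q Y) (t : ℤ) :
    Measurable (spectralTail Y t) :=
  (hY.measurable t).div (hY.measurable 0).abs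

variable [IsProbabilityMeasure Q]

lemma IsTailProcess.ae_one_lt (hY : IsTailProcess P α X Q Y) : ∀ᵐ ω ∂Q, 1 < |Y 0 ω| := by
  have mS : MeasurableSet {ω | 1 < |Y 0 ω|} :=
    measurableSet_lt measurable_const (hY.measurable 0).abs
  have h1 : ∀ y : ℝ, 1 < y → y ^ (-α) ≤ Q.real {ω | 1 < |Y 0 ω|} := fun y hy => by
    rw [← hY.pareto y hy]
    exact measureReal_mono (fun ω hω => lt_trans hy hω) (measure_ne_top _ _)
  have h2 : Tendsto (fun y : ℝ => y ^ (-α)) (𝓝[>] 1) (𝓝 1) := by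
    have : ContinuousAt (fun y : ℝ => y ^ (-α)) 1 := Real.continuousAt_rpow_const _ _
      (Or.inl one_ne_zero)
    have h3 := this.tendsto
    rw [Real.one_rpow] at h3
    exact h3.mono_left nhdsWithin_le_nhds
  have h3 : 1 ≤ Q.real {ω | 1 < |Y 0 ω|} :=
    le_of_tendsto h2 (by filter_upwards [self_mem_nhdsWithin] with y hy using h1 y hy)
  have h4 : Q.real {ω | 1 < |Y 0 ω|} = 1 := le_antisymm measureReal_le_one h3
  rw [measureReal_def, ENNReal.toReal_eq_one_iff] at h4
  exact (prob_compl_eq_zero_iff mS).2 h4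

lemma IsTailProcess.measure_lt (hY : IsTailProcess P α X Q Y) {u : ℝ} (hu : 1 ≤ u) :
    Q {ω | u < |Y 0 ω|} = ENNReal.ofReal (u ^ (-α)) := by
  rcases hu.eq_or_lt with rfl | hu
  · rw [Real.one_rpow, ENNReal.ofReal_one]
    refine le_antisymm prob_le_one ?_
    rw [← measure_univ (μ := Q)]
    refine measure_mono_ae ?_
    filter_upwards [hY.ae_one_lt] with ω hω _ using hω
  · rw [← hY.pareto u hu, ofReal_measureReal]

/-- The law of `|Y_0|` is the Pareto law. -/
lemma IsTailProcess.map_abs (hα : 0 < α) (hY : IsTailProcess P α X Q Y) :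
    Q.map (fun ω => |Y 0 ω|) = (powerMeasure α).restrict (Set.Ioi 1) := by
  have m0 : Measurable fun ω => |Y 0 ω| := (hY.measurable 0).abs
  have := Measure.isProbabilityMeasure_map (μ := Q) m0.aemeasurable
  have key : ∀ u : ℝ, Q.map (fun ω => |Y 0 ω|) (Set.Ioi u) =
      (powerMeasure α).restrict (Set.Ioi 1) (Set.Ioi u) := fun u => by
    rw [Measure.map_apply m0 measurableSet_Ioi, Measure.restrict_apply measurableSet_Ioi,
      Set.Ioi_inter_Ioi, powerMeasure_Ioi hα (lt_of_lt_of_le one_pos (le_max_right _ _)),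
      ← hY.measure_lt (le_max_right _ _)]
    refine measure_congr ?_
    filter_upwards [hY.ae_one_lt] with ω hω
    refine propext ?_
    change u < |Y 0 ω| ↔ max u 1 < |Y 0 ω|
    rw [max_lt_iff]
    exact ⟨fun h => ⟨h, hω⟩, fun h => h.1⟩
  refine ext_of_generate_finite _ (BorelSpace.measurable_eq.trans (borel_eq_generateFrom_Ioi ℝ))
    isPiSystem_Ioi ?_ ?_
  · rintro _ ⟨u, rfl⟩; exact key u
  · rw [measure_univ, Measure.restrict_apply_univ, powerMeasure_Ioi hα one_pos, Real.one_rpow,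
      ENNReal.ofReal_one]

lemma IsTailProcess.measure_eq_zero (hα : 0 < α) (hY : IsTailProcess P α X Q Y) (u : ℝ) :
    Q {ω | |Y 0 ω| = u} = 0 := by
  have m0 : Measurable fun ω => |Y 0 ω| := (hY.measurable 0).abs
  have h : Q.map (fun ω => |Y 0 ω|) {u} = 0 := by
    rw [hY.map_abs hα]; exact measure_singleton u
  rwa [Measure.map_apply m0 (measurableSet_singleton u)] at h

/-- The defining convergence of the tail process, extended to bounded functions which are
continuous off a closed null set of the limit. -/
lemma IsTailProcess.tendsto_setIntegral (hXm : ∀ t, Measurable (X t))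
    (hY : IsTailProcess P α X Q Y) (k : ℕ)
    {D : Set (Set.Icc (-(k : ℤ)) (k : ℤ) → ℝ)} (hD : IsClosed D)
    (hQD : Q {ω | (fun i : Set.Icc (-(k : ℤ)) (k : ℤ) => Y i ω) ∈ D} = 0)
    {g : (Set.Icc (-(k : ℤ)) (k : ℤ) → ℝ) → ℝ} (hg : Measurable g) {C : ℝ}
    (hC : ∀ y, |g y| ≤ C) (hcont : ContinuousOn g Dᶜ) :
    Tendsto (fun x : ℝ => (∫ ω in {ω | x < |X 0 ω|}, g (fun i => x⁻¹ * X i ω) ∂P) /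
      absTail P X x) atTop (𝓝 (∫ ω, g (fun i => Y i ω) ∂Q)) := by
  have mX : ∀ x : ℝ, Measurable fun ω (i : Set.Icc (-(k : ℤ)) (k : ℤ)) => x⁻¹ * X i ω := fun x =>
    measurable_pi_iff.2 fun i => (hXm _).const_mul _
  have mY : Measurable fun ω (i : Set.Icc (-(k : ℤ)) (k : ℤ)) => Y i ω :=
    measurable_pi_iff.2 fun i => hY.measurable _
  have h := tendsto_integral_of_continuousOn_compl (l := atTop)
    (μs := fun x : ℝ => (P[|{ω | x < |X 0 ω|}]).map
      fun ω (i : Set.Icc (-(k : ℤ)) (k : ℤ)) => x⁻¹ * X i ω)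
    (μ := Q.map fun ω (i : Set.Icc (-(k : ℤ)) (k : ℤ)) => Y i ω) (fun f => by
      have := hY.tendsto k f
      rw [integral_map mY.aemeasurable f.continuous.aestronglyMeasurable]
      refine this.congr fun x => ?_
      rw [integral_map (mX x).aemeasurable f.continuous.aestronglyMeasurable])
    hD (by rw [Measure.map_apply mY hD.measurableSet]; exact hQD) hg hC hcont
  rw [integral_map mY.aemeasurable hg.aestronglyMeasurable] at h
  refine h.congr fun x => ?_
  rw [integral_map (mX x).aemeasurable hg.aestronglyMeasurable, ProbabilityTheory.cond,
    integral_smul_measure, ENNReal.toReal_inv, smul_eq_mul, inv_mul_eq_div]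
  rfl

variable [IsProbabilityMeasure P]

/-- Independence of `|Y_0|` and the spectral tail process, in integrated form: the direction of
`(X_{-k}, …, X_k)` given `|X_0| > x` has the same limit when `x` is replaced by `u x`. -/
lemma IsTailProcess.setIntegral_spectralTail (hα : 0 < α) (hXm : ∀ t, Measurable (X t))
    (hstat : StrictlyStationary P X) (hRV : RegularlyVaryingSeq P α X)
    (hY : IsTailProcess P α X Q Y) (k : ℕ) (g : (Set.Icc (-(k : ℤ)) (k : ℤ) → ℝ) →ᵇ ℝ)
    {u : ℝ} (hu : 1 ≤ u) :
    ∫ ω in {ω | u < |Y 0 ω|}, g (fun i => spectralTail Y i ω) ∂Q =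
      u ^ (-α) * ∫ ω, g (fun i => spectralTail Y i ω) ∂Q := by
  have hu0 : 0 < u := one_pos.trans_le hu
  set o : Set.Icc (-(k : ℤ)) (k : ℤ) := ⟨0, by simp⟩ with ho
  -- the direction map, made continuous everywhere by changing it inside the unit ball
  set φ : (Set.Icc (-(k : ℤ)) (k : ℤ) → ℝ) → (Set.Icc (-(k : ℤ)) (k : ℤ) → ℝ) :=
    fun y i => y i / max |y o| 1 with hφ
  have φcont : Continuous φ := by
    refine continuous_pi fun i => ?_
    refine (continuous_apply i).div ((continuous_apply o).abs.max continuous_const) fun y => ?_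
    exact (lt_of_lt_of_le one_pos (le_max_right _ _)).ne'
  have hφY : ∀ᵐ ω ∂Q, φ (fun i => Y i ω) = fun i : Set.Icc (-(k : ℤ)) (k : ℤ) =>
      spectralTail Y i ω := by
    filter_upwards [hY.ae_one_lt] with ω hω
    ext i
    simp only [hφ, ho, spectralTail, max_eq_left hω.le]
  have gφ : Continuous fun y => g (φ y) := g.continuous.comp φcont
  have bound : ∀ y, |g (φ y)| ≤ ‖g‖ := fun y => g.norm_coe_le_norm _
  set D : Set (Set.Icc (-(k : ℤ)) (k : ℤ) → ℝ) := {y | |y o| = u}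
  have hD : IsClosed D := isClosed_eq (continuous_apply o).abs continuous_const
  set S : Set (Set.Icc (-(k : ℤ)) (k : ℤ) → ℝ) := {y | u < |y o|} with hS
  have mS : MeasurableSet S := measurableSet_lt measurable_const (measurable_pi_apply o).abs
  have h1 := hY.tendsto_setIntegral hXm k hD (hY.measure_eq_zero hα u)
    (g := S.indicator fun y => g (φ y)) (gφ.measurable.indicator mS) (C := ‖g‖)
    (fun y => by
      by_cases hy : y ∈ S
      · rw [Set.indicator_of_mem hy]; exact bound y
      · rw [Set.indicator_of_notMem hy, abs_zero]; exact norm_nonneg _)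
    (by
      intro y hy
      have hc := (continuous_apply (A := fun _ : Set.Icc (-(k : ℤ)) (k : ℤ) => ℝ) o).abs.continuousAt
        (x := y)
      refine ContinuousAt.continuousWithinAt ?_
      rcases lt_or_gt_of_ne (show |y o| ≠ u from hy) with h | h
      · have he : (fun _ => (0 : ℝ)) =ᶠ[𝓝 y] S.indicator fun y => g (φ y) := by
          filter_upwards [hc.eventually (gt_mem_nhds h)] with z hz
          exact (Set.indicator_of_notMem (s := S) (fun hz' : u < |z o| => lt_asymm hz hz')
            fun y => g (φ y)).symm
        exact continuousAt_const.congr he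
      · have he : (fun y => g (φ y)) =ᶠ[𝓝 y] S.indicator fun y => g (φ y) := by
          filter_upwards [hc.eventually (lt_mem_nhds h)] with z hz
          exact (Set.indicator_of_mem (show z ∈ S from hz) fun y => g (φ y)).symm
        exact gφ.continuousAt.congr he)
  have h2 := hY.tendsto_setIntegral hXm k isClosed_empty (by simp) gφ.measurable bound
    (by simpa using gφ)
  have h2' := (h2.comp (tendsto_id.const_mul_atTop hu0)).mul
    (absTail_regularVariation hstat hRV hu0)
  have hpos := absTail_pos (P := P) hstat hRV
  have h3 : ∀ᶠ x : ℝ in atTop,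
      (((fun x : ℝ => (∫ ω in {ω | x < |X 0 ω|}, g (φ fun i => x⁻¹ * X i ω) ∂P) /
        absTail P X x) ∘ fun x => u * id x) x) * (absTail P X (u * x) / absTail P X x) =
      (∫ ω in {ω | x < |X 0 ω|}, S.indicator (fun y => g (φ y)) (fun i => x⁻¹ * X i ω) ∂P) /
        absTail P X x := by
    filter_upwards [eventually_gt_atTop 0] with x hx
    have hp := (hpos (u * x)).ne'
    have hux : 0 < u * x := mul_pos hu0 hx
    simp only [Function.comp_apply, id]
    rw [div_mul_div_cancel₀ hp]
    congr 1
    have hmem : ∀ ω, (fun i : Set.Icc (-(k : ℤ)) (k : ℤ) => x⁻¹ * X i ω) ∈ S ↔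
        u * x < |X 0 ω| := fun ω => by
      change u < |x⁻¹ * X 0 ω| ↔ _
      rw [abs_mul, abs_of_pos (inv_pos.2 hx), inv_mul_eq_div, lt_div_iff₀ hx]
    have mF : ∀ x : ℝ, MeasurableSet {ω | x < |X 0 ω|} := fun x =>
      measurableSet_lt measurable_const (hXm 0).abs
    have e1 : ∀ ω, S.indicator (fun y => g (φ y)) (fun i => x⁻¹ * X i ω) =
        {ω | u * x < |X 0 ω|}.indicator (fun ω => g (φ fun i => (u * x)⁻¹ * X i ω)) ω := by
      intro ω
      by_cases hω : u * x < |X 0 ω|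
      · rw [Set.indicator_of_mem ((hmem ω).2 hω), Set.indicator_of_mem (by exact hω)]
        congr 1
        ext i
        have hX : 0 < |X 0 ω| := hux.trans hω
        have hx1 : x ≤ |X 0 ω| := (le_mul_of_one_le_left hx.le hu).trans hω.le
        have a1 : max |x⁻¹ * X 0 ω| 1 = x⁻¹ * |X 0 ω| := by
          rw [abs_mul, abs_of_pos (inv_pos.2 hx), max_eq_left]
          rw [inv_mul_eq_div, le_div_iff₀ hx, one_mul]; exact hx1
        have a2 : max |(u * x)⁻¹ * X 0 ω| 1 = (u * x)⁻¹ * |X 0 ω| := by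
          rw [abs_mul, abs_of_pos (inv_pos.2 hux), max_eq_left]
          rw [inv_mul_eq_div, le_div_iff₀ hux, one_mul]; exact hω.le
        simp only [hφ, ho, a1, a2]
        rw [mul_div_mul_left _ _ (inv_pos.2 hx).ne', mul_div_mul_left _ _ (inv_pos.2 hux).ne']
      · rw [Set.indicator_of_notMem (fun h => hω ((hmem ω).1 h)),
          Set.indicator_of_notMem (by exact hω)]
    simp only [e1]
    rw [setIntegral_indicator (mF _)]
    congr 2
    ext ω
    constructor
    · intro (h : u * x < |X 0 ω|)
      exact ⟨lt_of_le_of_lt (le_mul_of_one_le_left hx.le hu) h, h⟩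
    · intro h; exact h.2
  have h4 := tendsto_nhds_unique (h2'.congr' h3) h1
  have mY : Measurable fun ω (i : Set.Icc (-(k : ℤ)) (k : ℤ)) => Y i ω :=
    measurable_pi_iff.2 fun i => hY.measurable _
  have e5 : ∫ ω, g (φ fun i => Y i ω) ∂Q = ∫ ω, g (fun i => spectralTail Y i ω) ∂Q :=
    integral_congr_ae (hφY.mono fun ω h => by simp only [h])
  have e6 : ∫ ω, S.indicator (fun y => g (φ y)) (fun i => Y i ω) ∂Q =
      ∫ ω in {ω | u < |Y 0 ω|}, g (fun i => spectralTail Y i ω) ∂Q := by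
    rw [← integral_indicator (measurableSet_lt measurable_const (hY.measurable 0).abs)]
    refine integral_congr_ae (hφY.mono fun ω h => ?_)
    change S.indicator (fun y => g (φ y)) (fun i => Y i ω) = _
    by_cases hω : u < |Y 0 ω|
    · rw [Set.indicator_of_mem (show (fun i : Set.Icc (-(k : ℤ)) (k : ℤ) => Y i ω) ∈ S from hω),
        Set.indicator_of_mem (by exact hω), h]
    · rw [Set.indicator_of_notMem
        (show (fun i : Set.Icc (-(k : ℤ)) (k : ℤ) => Y i ω) ∉ S from hω),
        Set.indicator_of_notMem (by exact hω)]
  rw [e5, e6] at h4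
  rw [← h4, mul_comm]

/-- The joint law of `(ε |Y_0|, Θ)` is, up to the factor `ε ^ (-α)`, the product of the power
measure on `(ε, ∞)` and the law of `Θ`. -/
lemma IsTailProcess.map_polar (hα : 0 < α) (hXm : ∀ t, Measurable (X t))
    (hstat : StrictlyStationary P X) (hRV : RegularlyVaryingSeq P α X)
    (hY : IsTailProcess P α X Q Y) (k : ℕ) {ε : ℝ} (hε : 0 < ε) :
    ENNReal.ofReal (ε ^ (-α)) • Q.map (fun ω =>
        (ε * |Y 0 ω|, fun i : Set.Icc (-(k : ℤ)) (k : ℤ) => spectralTail Y i ω)) =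
      ((powerMeasure α).restrict (Set.Ioi ε)).prod
        (Q.map fun ω (i : Set.Icc (-(k : ℤ)) (k : ℤ)) => spectralTail Y i ω) := by
  have mΘ : Measurable fun ω (i : Set.Icc (-(k : ℤ)) (k : ℤ)) => spectralTail Y i ω :=
    measurable_pi_iff.2 fun i => hY.measurable_spectralTail _
  have mJ : Measurable fun ω =>
      (ε * |Y 0 ω|, fun i : Set.Icc (-(k : ℤ)) (k : ℤ) => spectralTail Y i ω) :=
    ((hY.measurable 0).abs.const_mul ε).prodMk mΘ
  have mS : ∀ u : ℝ, MeasurableSet {ω | u < |Y 0 ω|} := fun u =>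
    measurableSet_lt measurable_const (hY.measurable 0).abs
  have hfin := isFiniteMeasure_powerMeasure_restrict (α := α) hα hε
  have := Measure.isProbabilityMeasure_map (μ := Q) mΘ.aemeasurable
  have hcond : ∀ u : ℝ, 1 ≤ u →
      (Q.restrict {ω | u < |Y 0 ω|}).map (fun ω (i : Set.Icc (-(k : ℤ)) (k : ℤ)) =>
        spectralTail Y i ω) = ENNReal.ofReal (u ^ (-α)) •
        Q.map (fun ω (i : Set.Icc (-(k : ℤ)) (k : ℤ)) => spectralTail Y i ω) := by
    intro u hu
    have : IsFiniteMeasure (ENNReal.ofReal (u ^ (-α)) •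
        Q.map (fun ω (i : Set.Icc (-(k : ℤ)) (k : ℤ)) => spectralTail Y i ω)) :=
      Measure.smul_finite _ ENNReal.ofReal_ne_top
    refine ext_of_forall_integral_eq_of_IsFiniteMeasure fun g => ?_
    rw [integral_map mΘ.aemeasurable g.continuous.aestronglyMeasurable, integral_smul_measure,
      integral_map mΘ.aemeasurable g.continuous.aestronglyMeasurable,
      hY.setIntegral_spectralTail hα hXm hstat hRV k g hu,
      ENNReal.toReal_ofReal (Real.rpow_nonneg (by linarith) _), smul_eq_mul]
  symm
  refine Measure.prod_eq_generateFrom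
    ((BorelSpace.measurable_eq.trans (borel_eq_generateFrom_Ioi ℝ)).symm)
    MeasurableSpace.generateFrom_measurableSet isPiSystem_Ioi
    MeasurableSpace.isPiSystem_measurableSet
    ⟨fun n : ℕ => Set.Ioi (-(n : ℝ)), fun n => ⟨_, rfl⟩, fun n => measure_lt_top _ _, ?_⟩
    (Measure.toFiniteSpanningSetsIn _) ?_
  · refine Set.eq_univ_of_forall fun y => Set.mem_iUnion.2 ?_
    obtain ⟨n, hn⟩ := exists_nat_gt (-y)
    exact ⟨n, by simp only [Set.mem_Ioi]; linarith⟩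
  · rintro _ ⟨u, rfl⟩ B hB
    have hB : MeasurableSet B := hB
    set v : ℝ := max (u / ε) 1 with hv
    have hv1 : 1 ≤ v := le_max_right _ _
    have hεv : ε * v = max u ε := by
      rw [hv, mul_max_of_nonneg _ _ hε.le, mul_div_cancel₀ _ hε.ne', mul_one]
    rw [Measure.smul_apply, Measure.map_apply mJ (measurableSet_Ioi.prod hB), smul_eq_mul,
      Measure.restrict_apply measurableSet_Ioi, Set.Ioi_inter_Ioi, ← hεv,
      powerMeasure_Ioi hα (mul_pos hε (by linarith)), Real.mul_rpow hε.le (by linarith),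
      ENNReal.ofReal_mul (Real.rpow_nonneg hε.le _), mul_assoc]
    congr 1
    have h1 := congrArg (fun μ => μ B) (hcond v hv1)
    simp only [Measure.smul_apply, smul_eq_mul] at h1
    rw [← h1, Measure.map_apply mΘ hB, Measure.restrict_apply (mΘ hB)]
    refine measure_congr ?_
    filter_upwards [hY.ae_one_lt] with ω hω
    refine propext ?_
    change (u < ε * |Y 0 ω| ∧ _) ↔ (_ ∧ v < |Y 0 ω|)
    rw [hv, max_lt_iff, div_lt_iff₀ hε, mul_comm ε]
    constructor
    · intro h; exact ⟨h.2, h.1, hω⟩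
    · intro h; exact ⟨h.2.1, h.1⟩

lemma IsTailProcess.measure_abs_eq_one (hα : 0 < α) (hXm : ∀ t, Measurable (X t))
    (hstat : StrictlyStationary P X) (hRV : RegularlyVaryingSeq P α X)
    (hY : IsTailProcess P α X Q Y) (j : ℕ) : Q {ω | |Y j ω| = 1} = 0 := by
  set i : Set.Icc (-(j : ℤ)) (j : ℤ) := ⟨j, by simp⟩ with hi
  have h := hY.map_polar hα hXm hstat hRV j one_pos
  rw [Real.one_rpow, ENNReal.ofReal_one, one_smul] at h
  have mΘ : Measurable fun ω (i : Set.Icc (-(j : ℤ)) (j : ℤ)) => spectralTail Y i ω :=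
    measurable_pi_iff.2 fun i => hY.measurable_spectralTail _
  have mJ : Measurable fun ω =>
      (1 * |Y 0 ω|, fun i : Set.Icc (-(j : ℤ)) (j : ℤ) => spectralTail Y i ω) :=
    ((hY.measurable 0).abs.const_mul 1).prodMk mΘ
  set B : Set (ℝ × (Set.Icc (-(j : ℤ)) (j : ℤ) → ℝ)) := {p | p.1 * |p.2 i| = 1}
  have mB : MeasurableSet B := measurableSet_eq_fun
    (measurable_fst.mul ((measurable_pi_apply i).comp measurable_snd).abs) measurable_const
  have h0 : ((powerMeasure α).restrict (Set.Ioi 1)).prod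
      (Q.map fun ω (i : Set.Icc (-(j : ℤ)) (j : ℤ)) => spectralTail Y i ω) B = 0 := by
    rw [Measure.prod_apply_symm mB]
    refine lintegral_eq_zero_of_ae_eq_zero (ae_of_all _ fun θ => ?_)
    refine measure_mono_null (fun r (hr : r * |θ i| = 1) => ?_)
      (measure_singleton (μ := (powerMeasure α).restrict (Set.Ioi 1)) (|θ i|⁻¹))
    exact eq_inv_of_mul_eq_one_left hr
  rw [← h, Measure.map_apply mJ mB] at h0
  refine measure_mono_null_ae ?_ h0
  filter_upwards [hY.ae_one_lt] with ω hω (hω1 : |Y j ω| = 1)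
  change 1 * |Y 0 ω| * abs (Y j ω / |Y 0 ω|) = 1
  rw [abs_div, abs_abs, hω1, one_mul, mul_one_div_cancel (by linarith)]

/-- Extension of a finite window of a sequence by zero. -/
def windowSeq (k : ℕ) (y : Set.Icc (-(k : ℤ)) (k : ℤ) → ℝ) (j : ℕ) : ℝ :=
  if h : (j : ℤ) ∈ Set.Icc (-(k : ℤ)) (k : ℤ) then y ⟨j, h⟩ else 0

lemma windowSeq_of_le {k j : ℕ} (hj : j ≤ k) (z : ℤ → ℝ) :
    windowSeq k (fun i => z i) j = z j := by
  unfold windowSeq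
  rw [dif_pos]
  exact ⟨by omega, by omega⟩

lemma continuous_windowSeq (k j : ℕ) : Continuous fun y => windowSeq k y j := by
  unfold windowSeq
  split_ifs <;> fun_prop

/-- The limiting expected gain of a cluster started at an exceedance of `ε x`. -/
def clusterLimit (Q : Measure Ω') (α : ℝ) (Θ : ℤ → Ω' → ℝ) (ρ M a : ℝ) (ε : ℝ) (k : ℕ) : ℝ :=
  ∫ p : ℝ × Ω', gain ρ M a k (fun j => cut ε (p.1 * Θ j p.2))
    ∂(((powerMeasure α).restrict (Set.Ioi ε)).prod Q)

/-- Convergence of the expected gain given an exceedance of `ε x`. The conditioning level `ε x`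
turns `Y_j` into `ε Y_j = (ε |Y_0|) Θ_j`, and the thresholding at `ε` is discontinuous only where
some `|Y_j| = 1`, which has probability zero. -/
lemma IsTailProcess.tendsto_gain (hα : 0 < α) (hXm : ∀ t, Measurable (X t))
    (hstat : StrictlyStationary P X) (hRV : RegularlyVaryingSeq P α X)
    (hY : IsTailProcess P α X Q Y) {ρ M a ε : ℝ} (hM : 0 ≤ M) (hε : 0 < ε) (k : ℕ) :
    Tendsto (fun x : ℝ => (∫ ω in {ω | ε * x < |X 0 ω|},
        gain ρ M a k (fun j => cut ε (x⁻¹ * X j ω)) ∂P) / absTail P X x) atTop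
      (𝓝 (clusterLimit Q α (spectralTail Y) ρ M a ε k)) := by
  have hfin := isFiniteMeasure_powerMeasure_restrict (α := α) hα hε
  have mΘ : Measurable fun ω (i : Set.Icc (-(k : ℤ)) (k : ℤ)) => spectralTail Y i ω :=
    measurable_pi_iff.2 fun i => hY.measurable_spectralTail _
  have mJ : Measurable fun ω =>
      (ε * |Y 0 ω|, fun i : Set.Icc (-(k : ℤ)) (k : ℤ) => spectralTail Y i ω) :=
    ((hY.measurable 0).abs.const_mul ε).prodMk mΘ
  set g : (Set.Icc (-(k : ℤ)) (k : ℤ) → ℝ) → ℝ :=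
    fun y => gain ρ M a k (fun j => cut ε (ε * windowSeq k y j)) with hg
  have mg : Measurable g := (continuous_gain ρ M a k).measurable.comp
    (measurable_pi_iff.2 fun j => (measurable_cut ε).comp
      ((continuous_windowSeq k j).measurable.const_mul ε))
  set D : Set (Set.Icc (-(k : ℤ)) (k : ℤ) → ℝ) :=
    ⋃ j ∈ Finset.range (k + 1), {y | |windowSeq k y j| = 1} with hDdef
  have hD : IsClosed D := isClosed_biUnion_finset fun j _ =>
    isClosed_eq (continuous_windowSeq k j).abs continuous_const
  have hQD : Q {ω | (fun i : Set.Icc (-(k : ℤ)) (k : ℤ) => Y i ω) ∈ D} = 0 := by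
    have : {ω | (fun i : Set.Icc (-(k : ℤ)) (k : ℤ) => Y i ω) ∈ D} ⊆
        ⋃ j : ℕ, {ω | |Y j ω| = 1} := by
      intro ω hω
      simp only [hDdef, Set.mem_ofPred_eq, Set.mem_iUnion, Finset.mem_range] at hω ⊢
      obtain ⟨j, hj, h⟩ := hω
      rw [windowSeq_of_le (by omega : j ≤ k) (fun t => Y t ω)] at h
      exact ⟨j, h⟩
    exact measure_mono_null this
      (measure_iUnion_null fun j => hY.measure_abs_eq_one hα hXm hstat hRV j)
  have gcongr' : ∀ y, g y = gain ρ M a k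
      (fun j => if j ≤ k then cut ε (ε * windowSeq k y j) else 0) := fun y =>
    gain_congr fun j hj => (if_pos hj).symm
  have hcont : ContinuousOn g Dᶜ := by
    intro y hy
    refine ContinuousAt.continuousWithinAt ?_
    have : ContinuousAt (fun y : Set.Icc (-(k : ℤ)) (k : ℤ) → ℝ => fun j : ℕ =>
        if j ≤ k then cut ε (ε * windowSeq k y j) else 0) y := by
      refine continuousAt_pi.2 fun j => ?_
      by_cases hj : j ≤ k
      · simp only [if_pos hj]
        refine ContinuousAt.comp (g := cut ε) (continuousAt_cut ?_)
          ((continuous_windowSeq k j).continuousAt.const_mul ε)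
        intro h
        rw [abs_mul, abs_of_pos hε] at h
        refine hy ?_
        simp only [hDdef, Set.mem_iUnion, Finset.mem_range]
        exact ⟨j, by omega, by
          change |windowSeq k y j| = 1
          have := mul_left_cancel₀ hε.ne' (h.trans (mul_one ε).symm)
          exact this⟩
      · simp only [if_neg hj]; exact continuousAt_const
    have h2 := (continuous_gain ρ M a k).continuousAt.comp this
    exact h2.congr (Eventually.of_forall fun y => (gcongr' y).symm)
  have h1 := hY.tendsto_setIntegral hXm k hD hQD mg (fun y => abs_gain_le hM _ _ _ _) hcont
  have h2 := (h1.comp (tendsto_id.const_mul_atTop hε)).mul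
    (absTail_regularVariation hstat hRV hε)
  have hpos := absTail_pos (P := P) hstat hRV
  -- identification of the limit through the polar decomposition
  set G : ℝ × (Set.Icc (-(k : ℤ)) (k : ℤ) → ℝ) → ℝ :=
    fun p => gain ρ M a k (fun j => cut ε (p.1 * windowSeq k p.2 j)) with hG
  have mG : Measurable G := (continuous_gain ρ M a k).measurable.comp
    (measurable_pi_iff.2 fun j => (measurable_cut ε).comp
      (measurable_fst.mul ((continuous_windowSeq k j).measurable.comp measurable_snd)))
  have e1 : ∫ ω, g (fun i => Y i ω) ∂Q =
      ∫ ω, G (ε * |Y 0 ω|, fun i => spectralTail Y i ω) ∂Q := by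
    refine integral_congr_ae (hY.ae_one_lt.mono fun ω hω => ?_)
    refine gain_congr fun j hj => ?_
    rw [windowSeq_of_le hj (fun t => Y t ω), windowSeq_of_le hj (fun t => spectralTail Y t ω)]
    have h0 : |Y 0 ω| ≠ 0 := by linarith
    unfold spectralTail
    rw [mul_assoc, mul_div_cancel₀ _ h0]
  have e2 : (∫ ω, g (fun i => Y i ω) ∂Q) * ε ^ (-α) =
      clusterLimit Q α (spectralTail Y) ρ M a ε k := by
    have hm := Measure.map_prod_map ((powerMeasure α).restrict (Set.Ioi ε)) Q measurable_id mΘ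
    rw [Measure.map_id] at hm
    have hp := hY.map_polar hα hXm hstat hRV k hε
    rw [hm] at hp
    have := congrArg (fun μ => ∫ p, G p ∂μ) hp
    rw [integral_smul_measure, integral_map mJ.aemeasurable mG.aestronglyMeasurable,
      integral_map (measurable_id.prodMap mΘ).aemeasurable mG.aestronglyMeasurable, ← e1,
      ENNReal.toReal_ofReal (Real.rpow_nonneg hε.le _), smul_eq_mul] at this
    rw [mul_comm, this]
    refine integral_congr_ae (ae_of_all _ fun p => gain_congr fun j hj => ?_)
    simp only [Prod.map, id]
    rw [windowSeq_of_le hj (fun t => spectralTail Y t p.2)]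
  rw [e2] at h2
  refine h2.congr' ?_
  filter_upwards [eventually_gt_atTop 0] with x hx
  have hp := (hpos (ε * x)).ne'
  simp only [Function.comp_apply, id]
  rw [div_mul_div_cancel₀ hp]
  congr 1
  refine integral_congr_ae (ae_of_all _ fun ω => gain_congr fun j hj => ?_)
  rw [windowSeq_of_le hj (fun t => (ε * x)⁻¹ * X t ω), mul_inv, mul_assoc,
    mul_inv_cancel_left₀ hε.ne']

end Tail

/-! ### Reduction of the ruin probability to cluster limits -/

lemma tendsto_floor_mul_add {M : ℝ} (hM : 0 < M) (k : ℕ) :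
    Tendsto (fun x : ℝ => ⌊M * x⌋₊ + k) atTop atTop :=
  (tendsto_add_atTop_nat k).comp
    (tendsto_nat_floor_atTop.comp (tendsto_id.const_mul_atTop hM))

/-- The time horizon `⌊M x⌋ + k` is comparable with `M x`. -/
lemma eventually_floor_mul_add_bounds {M : ℝ} (hM : 0 < M) (k : ℕ) :
    ∀ᶠ x : ℝ in atTop, ((⌊M * x⌋₊ + k : ℕ) : ℝ) ≤ 2 * M * x ∧
      x ∈ Set.Icc (1 / (2 * M) * ((⌊M * x⌋₊ + k : ℕ) : ℝ)) (2 / M * ((⌊M * x⌋₊ + k : ℕ) : ℝ)) := by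
  filter_upwards [eventually_ge_atTop ((k + 2) / M), eventually_gt_atTop 0] with x hx hx0
  rw [div_le_iff₀ hM, mul_comm x] at hx
  have h1 := Nat.floor_le (mul_pos hM hx0).le
  have h2 := Nat.lt_floor_add_one (M * x)
  have hk : (0 : ℝ) ≤ k := Nat.cast_nonneg k
  have h3 : ((⌊M * x⌋₊ + k : ℕ) : ℝ) ≤ 2 * M * x := by push_cast; linarith
  refine ⟨h3, ?_, ?_⟩
  · rw [one_div, inv_mul_le_iff₀ (by positivity)]; exact h3
  · rw [div_mul_eq_mul_div, le_div_iff₀ hM]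
    push_cast
    linarith

lemma lt_iSup_walk_iff {Ω : Type*} (X : ℤ → Ω → ℝ) (ρ x : ℝ) (ω : Ω) :
    ((x : EReal) < ⨆ t : ℕ, ((partialSum X t ω - ρ * t : ℝ) : EReal)) ↔
      ∃ t : ℕ, x < partialSum X t ω - ρ * t := by
  rw [lt_iSup_iff]
  simp only [EReal.coe_lt_coe_iff]

section Tail

variable {Ω Ω' : Type*} [MeasurableSpace Ω] [MeasurableSpace Ω']
  {P : Measure Ω} [IsProbabilityMeasure P] {Q : Measure Ω'} [IsProbabilityMeasure Q]
  {X : ℤ → Ω → ℝ} {Y : ℤ → Ω' → ℝ} {α : ℝ}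

/-- The event that the sums of the increments larger than `ε x` cross the line `a x + ρ t` before
the time horizon `⌊M x⌋ + k`. -/
def bigCrossing (X : ℤ → Ω → ℝ) (ρ M a ε : ℝ) (k : ℕ) (x : ℝ) : Set Ω :=
  {ω | CrossesFrom ρ (a * x) (⌊M * x⌋₊ + k) (fun j => cut (ε * x) (X ((j : ℤ) + 1) ω)) 0}

/-- Scaling of the gain functional by the level `x`. -/
lemma gain_scaling {x : ℝ} (hx : 0 < x) (ρ M a ε : ℝ) (n k : ℕ) (z : ℕ → ℝ) :
    |gain ρ n (a * x) k (fun j => cut (ε * x) (z j)) -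
        x * gain ρ M a k (fun j => cut ε (x⁻¹ * z j))| ≤ 2 * |n - M * x| := by
  have e1 : gain ρ n (a * x) k (fun j => cut (ε * x) (z j)) =
      x * gain ρ (n / x) a k (fun j => cut ε (x⁻¹ * z j)) := by
    rw [← gain_mul hx, mul_div_cancel₀ _ hx.ne', mul_comm x a]
    congr 1
    ext j
    rw [← cut_mul hx, mul_inv_cancel_left₀ hx.ne']
  rw [e1, ← mul_sub, abs_mul, abs_of_pos hx]
  have h := abs_gain_horizon_sub_le ρ (n / x) M a k (fun j => cut ε (x⁻¹ * z j))
  calc _ ≤ x * (2 * |n / x - M|) := mul_le_mul_of_nonneg_left h hx.le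
    _ = 2 * (|x| * |n / x - M|) := by rw [abs_of_pos hx]; ring
    _ = _ := by rw [← abs_mul, mul_sub, mul_div_cancel₀ _ hx.ne', mul_comm M]

/-- Anti-clustering makes the error of `abs_crossing_sub_gain_le` negligible with respect to
`x P(|X_0| > x)`, so that the crossing probability is close to the cluster limit for large `k`. -/
lemma IsTailProcess.measureReal_bigCrossing_approx (hα : 0 < α) (hXm : ∀ t, Measurable (X t))
    (hstat : StrictlyStationary P X) (hRV : RegularlyVaryingSeq P α X)
    (hY : IsTailProcess P α X Q Y)
    (hAC : ∀ C₁ C₂ : ℝ, 0 < C₁ → C₁ < C₂ →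
      AntiClustering P X (fun n => Set.Icc (C₁ * n) (C₂ * n)))
    {ρ M a ε κ : ℝ} (hρ : 0 < ρ) (hM : 0 < M) (ha : 0 < a) (hε : 0 < ε) (hκ : 0 < κ) :
    ∀ᶠ k : ℕ in atTop, ∀ᶠ x : ℝ in atTop,
      |P.real (bigCrossing X ρ M a ε k x) / (x * absTail P X x) -
        clusterLimit Q α (spectralTail Y) ρ M a ε k| ≤ κ := by
  have hpos := absTail_pos (P := P) hstat hRV
  have hεα : 0 < ε ^ (-α) := Real.rpow_pos_of_pos hε _
  set η : ℝ := κ / (8 * M * ε ^ (-α)) with hη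
  have hη0 : 0 < η := by positivity
  have hC : (1 : ℝ) / (2 * M) < 2 / M := by
    rw [div_lt_div_iff₀ (by positivity) hM]; linarith
  have hac := (hAC (1 / (2 * M)) (2 / M) (by positivity) hC).exists_bound hXm hε hη0
  filter_upwards [(tendsto_add_atTop_nat 1).eventually hac] with k hk
  have hr := absTail_regularVariation (P := P) hstat hRV hε
  have herr : Tendsto (fun x : ℝ => absTail P X (ε * x) / absTail P X x *
      ((2 * k + 5) / x + 2 * M * η)) atTop (𝓝 (ε ^ (-α) * (0 + 2 * M * η))) :=
    hr.mul ((tendsto_const_nhds.div_atTop tendsto_id).add_const _)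
  have hsmall : ε ^ (-α) * (0 + 2 * M * η) < κ / 2 := by
    have : ε ^ (-α) * (0 + 2 * M * η) = κ / 4 := by
      rw [hη]; field_simp; ring
    rw [this]; linarith
  have hgain := Metric.tendsto_nhds.1
    (hY.tendsto_gain hα hXm hstat hRV (ρ := ρ) (a := a) hM.le hε k) (κ / 2) (by positivity)
  filter_upwards [(tendsto_floor_mul_add hM k).eventually hk,
    eventually_floor_mul_add_bounds hM k, herr.eventually (gt_mem_nhds hsmall), hgain,
    eventually_gt_atTop 0] with x hx1 hx2 hx3 hx4 hx0
  set n : ℕ := ⌊M * x⌋₊ with hn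
  set p : ℝ := absTail P X x with hp
  set pε : ℝ := absTail P X (ε * x) with hpε
  have hp0 : 0 < p := hpos x
  have hpε0 : 0 < pε := hpos _
  have hFG := hx1 x hx2.2
  have hnle : (n : ℝ) ≤ M * x := Nat.floor_le (by positivity)
  have hnge : M * x < n + 1 := Nat.lt_floor_add_one _
  have hcl := abs_crossing_sub_gain_le (P := P) hXm hstat hρ (mul_pos ha hx0) (c := ε * x) n k
  set I : ℝ := ∫ ω in {ω | ε * x < |X 0 ω|}, gain ρ M a k (fun j => cut ε (x⁻¹ * X j ω)) ∂P
    with hI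
  set J : ℝ := ∫ ω in {ω | ε * x < |X 0 ω|}, gain ρ n (a * x) k (fun j => cut (ε * x) (X j ω)) ∂P
    with hJ
  have mz : ∀ (M' a' c y : ℝ),
      Measurable fun ω => gain ρ M' a' k (fun j => cut c (y * X j ω)) := fun M' a' c y => by
    have h := (continuous_gain ρ M' a' k).measurable.comp
      (measurable_pi_iff.2 fun j : ℕ => (measurable_cut c).comp ((hXm j).const_mul y))
    exact h
  have i1 : Integrable (fun ω => gain ρ M a k (fun j => cut ε (x⁻¹ * X j ω)))
      (P.restrict {ω | ε * x < |X 0 ω|}) :=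
    Integrable.of_bound (mz _ _ _ _).aestronglyMeasurable M
      (ae_of_all _ fun ω => abs_gain_le hM.le _ _ _ _)
  have i2 : Integrable (fun ω => gain ρ n (a * x) k (fun j => cut (ε * x) (X j ω)))
      (P.restrict {ω | ε * x < |X 0 ω|}) := by
    have := mz n (a * x) (ε * x) 1
    simp only [one_mul] at this
    exact Integrable.of_bound this.aestronglyMeasurable n
      (ae_of_all _ fun ω => abs_gain_le (Nat.cast_nonneg n) _ _ _ _)
  have hJI : |J - x * I| ≤ 2 * pε := by
    rw [hJ, hI, ← integral_const_mul, ← integral_sub i2 (i1.const_mul x), ← Real.norm_eq_abs]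
    refine (norm_integral_le_of_norm_le_const (μ := P.restrict {ω | ε * x < |X 0 ω|}) (C := 2) (ae_of_all _ fun ω => ?_)).trans ?_
    · rw [Real.norm_eq_abs]
      refine (gain_scaling hx0 ρ M a ε n k fun j => X j ω).trans ?_
      have : |(n : ℝ) - M * x| ≤ 1 := by rw [abs_le]; constructor <;> linarith
      linarith
    · rw [measureReal_restrict_apply_univ]
      exact le_rfl
  have hFG' : P.real {ω | ε * x < |X 0 ω| ∧ ∃ l : ℕ, k + 1 ≤ l ∧ l ≤ n + k ∧ ε * x < |X l ω|} ≤
      η * pε := hFG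
  have htot : |P.real (bigCrossing X ρ M a ε k x) - x * I| ≤ pε * ((2 * k + 5) + 2 * M * η * x) := by
    have h1 : |P.real (bigCrossing X ρ M a ε k x) - J| ≤ (2 * k + 3) * pε + 2 * n * (η * pε) := by
      refine hcl.trans ?_
      gcongr
      exact le_rfl
    have h2 : 2 * (n : ℝ) * (η * pε) ≤ 2 * (M * x) * (η * pε) := by gcongr
    calc _ ≤ |P.real (bigCrossing X ρ M a ε k x) - J| + |J - x * I| := abs_sub_le _ _ _
      _ ≤ (2 * k + 3) * pε + 2 * (M * x) * (η * pε) + 2 * pε := by linarith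
      _ = _ := by ring
  have hmain : |P.real (bigCrossing X ρ M a ε k x) / (x * p) - I / p| ≤ κ / 2 := by
    have e : P.real (bigCrossing X ρ M a ε k x) / (x * p) - I / p =
        (P.real (bigCrossing X ρ M a ε k x) - x * I) / (x * p) := by
      field_simp
    rw [e, abs_div, abs_of_pos (mul_pos hx0 hp0), div_le_iff₀ (mul_pos hx0 hp0)]
    refine htot.trans ?_
    have : pε * ((2 * k + 5) + 2 * M * η * x) =
        (pε / p * ((2 * k + 5) / x + 2 * M * η)) * (x * p) := by
      field_simp
    rw [this]
    gcongr
  rw [Real.dist_eq] at hx4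
  calc _ ≤ _ := abs_sub_le _ (I / p) _
    _ ≤ κ / 2 + κ / 2 := add_le_add hmain hx4.le
    _ = κ := by ring

/-- Ruin happens through large increments before the time horizon, or the small increments are
large in sum, or it happens late. -/
lemma ruinProb_le (ρ M δ ε : ℝ) (k : ℕ) (x : ℝ) :
    ruinProb P X ρ x ≤ P.real (bigCrossing X ρ M (1 - δ) ε k x) +
      P.real {ω | ∃ t ≤ ⌊M * x⌋₊ + k, δ * x < |partialSum (trunc (ε * x) X) t ω|} +
      P.real {ω | ∃ t > ⌊M * x⌋₊ + k, x < partialSum X t ω - ρ * t} := by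
  unfold ruinProb
  simp only [lt_iSup_walk_iff]
  refine (measureReal_mono (s₂ := (bigCrossing X ρ M (1 - δ) ε k x ∪
    {ω | ∃ t ≤ ⌊M * x⌋₊ + k, δ * x < |partialSum (trunc (ε * x) X) t ω|}) ∪
    {ω | ∃ t > ⌊M * x⌋₊ + k, x < partialSum X t ω - ρ * t}) ?_ (measure_ne_top _ _)).trans ?_
  · rintro ω ⟨t, ht⟩
    by_cases hN : t ≤ ⌊M * x⌋₊ + k
    · left
      by_cases hT : δ * x < |partialSum (trunc (ε * x) X) t ω|
      · exact Or.inr ⟨t, hN, hT⟩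
      · left
        refine ⟨t, by omega, ?_⟩
        rw [partialSum_eq_trunc_add_cut X (ε * x)] at ht
        simp only [zero_add]
        linarith [le_abs_self (partialSum (trunc (ε * x) X) t ω), not_lt.1 hT]
    · exact Or.inr ⟨t, not_le.1 hN, ht⟩
  · exact (measureReal_union_le _ _).trans (add_le_add_left (measureReal_union_le _ _) _)

lemma measureReal_bigCrossing_le (ρ M δ ε : ℝ) (k : ℕ) (x : ℝ) :
    P.real (bigCrossing X ρ M (1 + δ) ε k x) ≤ ruinProb P X ρ x +
      P.real {ω | ∃ t ≤ ⌊M * x⌋₊ + k, δ * x < |partialSum (trunc (ε * x) X) t ω|} := by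
  unfold ruinProb
  simp only [lt_iSup_walk_iff]
  refine (measureReal_mono ?_ (measure_ne_top _ _)).trans (measureReal_union_le _ _)
  rintro ω ⟨t, hN, ht⟩
  by_cases hT : δ * x < |partialSum (trunc (ε * x) X) t ω|
  · exact Or.inr ⟨t, by omega, hT⟩
  · left
    refine ⟨t, ?_⟩
    rw [partialSum_eq_trunc_add_cut X (ε * x)]
    simp only [zero_add] at ht
    linarith [neg_abs_le (partialSum (trunc (ε * x) X) t ω), not_lt.1 hT]

/-- The ruin probability is asymptotic to the iterated limit of the cluster functionals. -/
lemma IsTailProcess.tendsto_ruinProb (hα : 1 < α) (hXm : ∀ t, Measurable (X t))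
    (hstat : StrictlyStationary P X) (hRV : RegularlyVaryingSeq P α X)
    (hY : IsTailProcess P α X Q Y)
    (hAC : ∀ C₁ C₂ : ℝ, 0 < C₁ → C₁ < C₂ →
      AntiClustering P X (fun n => Set.Icc (C₁ * n) (C₂ * n)))
    (hVSV : ∀ C₁ C₂ : ℝ, 0 < C₁ → C₁ < C₂ →
      VanishingSmallValues P X (fun n => Set.Icc (C₁ * n) (C₂ * n)))
    {ρ L : ℝ} (hρ : 0 < ρ)
    (hL : ∀ κ > 0, ∀ᶠ M : ℝ in atTop, ∀ᶠ a : ℝ in 𝓝 1, ∀ᶠ ε : ℝ in 𝓝[>] 0, ∀ᶠ k : ℕ in atTop,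
      |clusterLimit Q α (spectralTail Y) ρ M a ε k - L| < κ) :
    Tendsto (fun x : ℝ => ruinProb P X ρ x / (x * absTail P X x)) atTop (𝓝 L) := by
  have hα0 : 0 < α := by linarith
  have hpos := absTail_pos (P := P) hstat hRV
  obtain ⟨C, hC, hlate⟩ := exists_measureReal_late_crossing_le hα hstat hRV
    (hVSV _ _ (by norm_num) (by norm_num)) hρ
  rw [Metric.tendsto_nhds]
  intro r hr
  set κ : ℝ := r / 5 with hκ
  have hκ0 : 0 < κ := by positivity
  -- the horizon: late crossings contribute at most `2 C M ^ (1 - α)`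
  have hMlim : Tendsto (fun M : ℝ => 2 * C * M ^ (-(α - 1))) atTop (𝓝 (2 * C * 0)) :=
    (tendsto_rpow_neg_atTop (by linarith)).const_mul _
  obtain ⟨M, ⟨hM1, hM2⟩, hM⟩ := (((hL κ hκ0).and (hMlim.eventually
    (gt_mem_nhds (show 2 * C * 0 < κ by simpa)))).and (eventually_gt_atTop 0)).exists
  -- the levels `1 ± δ`
  obtain ⟨δ₀, hδ₀, hball⟩ := Metric.eventually_nhds_iff.1 hM1
  set δ : ℝ := min (δ₀ / 2) (1 / 2) with hδ
  have hδ0 : 0 < δ := by positivity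
  have hδ1 : δ < δ₀ := (min_le_left _ _).trans_lt (by linarith)
  have hδ2 : δ ≤ 1 / 2 := min_le_right _ _
  have hup := hball (y := 1 - δ) (by rw [Real.dist_eq, abs_sub_comm, abs_of_pos] <;> linarith)
  have hlo := hball (y := 1 + δ) (by rw [Real.dist_eq, abs_of_pos] <;> linarith)
  -- the truncation level and the cluster length
  have hC12 : (1 : ℝ) / (2 * M) < 2 / M := by
    rw [div_lt_div_iff₀ (by positivity) hM]; linarith
  have hv := (hVSV (1 / (2 * M)) (2 / M) (by positivity) hC12).exists_bound (by positivity) hpos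
    hδ0 (show 0 < κ / (2 * M) by positivity)
  obtain ⟨ε, ⟨⟨hε1, hε2⟩, hε3⟩, hε⟩ := (((hup.and hlo).and hv).and self_mem_nhdsWithin).exists
  have hε : 0 < ε := hε
  have hk1 := hY.measureReal_bigCrossing_approx hα0 hXm hstat hRV hAC hρ hM
    (show 0 < 1 - δ by linarith) hε hκ0
  have hk2 := hY.measureReal_bigCrossing_approx hα0 hXm hstat hRV hAC hρ hM
    (show 0 < 1 + δ by linarith) hε hκ0
  obtain ⟨k, ⟨⟨⟨hkup, hklo⟩, hk1⟩, hk2⟩, hk0⟩ :=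
    ((((hε1.and hε2).and hk1).and hk2).and (eventually_gt_atTop 0)).exists
  have hlast : Tendsto (fun x => 2 * C * M * (absTail P X (M * x) / absTail P X x)) atTop
      (𝓝 (2 * C * M * M ^ (-α))) := (absTail_regularVariation hstat hRV hM).const_mul _
  have hlast' : 2 * C * M * M ^ (-α) < κ := by
    have : M ^ (-(α - 1)) = M * M ^ (-α) := by
      rw [neg_sub, sub_eq_add_neg, Real.rpow_add hM, Real.rpow_one]
    rwa [this, ← mul_assoc] at hM2
  filter_upwards [hk1, hk2, (tendsto_floor_mul_add hM k).eventually hε3,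
    (tendsto_floor_mul_add hM k).eventually hlate, eventually_floor_mul_add_bounds hM k,
    hlast.eventually (gt_mem_nhds hlast'), eventually_gt_atTop 0] with x h1 h2 h3 h4 h5 h6 hx
  have h3 := h3 x h5.2
  have h4 := h4 x hx.le
  set N : ℕ := ⌊M * x⌋₊ + k with hN
  have hp0 := hpos x
  have hxp : 0 < x * absTail P X x := mul_pos hx hp0
  have hMN : M * x ≤ N := by
    have := Nat.lt_floor_add_one (M * x)
    have hk' : (1 : ℝ) ≤ k := by exact_mod_cast hk0
    rw [hN]; push_cast; linarith
  have hsmallv : P.real {ω | ∃ t ≤ N, δ * x < |partialSum (trunc (ε * x) X) t ω|} ≤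
      κ * (x * absTail P X x) := by
    refine h3.trans ?_
    calc κ / (2 * M) * N * absTail P X x ≤ κ / (2 * M) * (2 * M * x) * absTail P X x := by
          gcongr; exact h5.1
      _ = _ := by field_simp
  have hlatev : P.real {ω | ∃ t > N, x < partialSum X t ω - ρ * t} ≤
      κ * (x * absTail P X x) := by
    refine h4.trans ?_
    calc C * (N * absTail P X N) ≤ C * (2 * M * x * absTail P X (M * x)) := by
          have := absTail_anti (P := P) (X := X) hMN
          have h0 := (hpos (M * x)).le
          have h0' := (hpos N).le
          have h7 := h5.1
          gcongr
      _ = (2 * C * M * (absTail P X (M * x) / absTail P X x)) * (x * absTail P X x) := by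
          field_simp
      _ ≤ _ := by gcongr
  have hR1 := ruinProb_le (P := P) (X := X) ρ M δ ε k x
  have hR2 := measureReal_bigCrossing_le (P := P) (X := X) ρ M δ ε k x
  rw [abs_le] at h1 h2
  rw [abs_lt] at hkup hklo
  have b1 : P.real (bigCrossing X ρ M (1 - δ) ε k x) ≤ (L + 2 * κ) * (x * absTail P X x) := by
    rw [← div_le_iff₀ hxp]; linarith [h1.2, hkup.2]
  have b2 : (L - 2 * κ) * (x * absTail P X x) ≤ P.real (bigCrossing X ρ M (1 + δ) ε k x) := by
    rw [← le_div_iff₀ hxp]; linarith [h2.1, hklo.1]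
  have c1 : ruinProb P X ρ x / (x * absTail P X x) ≤ L + 4 * κ := by
    rw [div_le_iff₀ hxp]; linarith
  have c2 : L - 3 * κ ≤ ruinProb P X ρ x / (x * absTail P X x) := by
    rw [le_div_iff₀ hxp]; linarith
  rw [Real.dist_eq, abs_lt]
  constructor <;> linarith

end Tail

/-! ### Infinite horizon maxima -/

/-- The positive part of the supremum of the partial sums of an infinite sequence. -/
def posSup (z : ℕ → ℝ) : ℝ := max (⨆ t : ℕ, ∑ i ∈ Finset.range (t + 1), z i) 0

lemma posSup_nonneg (z : ℕ → ℝ) : 0 ≤ posSup z := le_max_right _ _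

lemma ruinFunctional_eq {Ω' : Type*} (α : ℝ) (Θ : ℤ → Ω' → ℝ) (ω : Ω') :
    ruinFunctional α Θ ω = posSup (fun j : ℕ => Θ j ω) ^ α -
      posSup (fun j : ℕ => Θ ((j + 1 : ℕ) : ℤ) ω) ^ α := by
  unfold ruinFunctional posSup
  have h1 : ∀ t : ℕ, ∑ i ∈ Finset.Icc (0 : ℕ) t, Θ ((i : ℕ) : ℤ) ω =
      ∑ i ∈ Finset.range (t + 1), Θ ((i : ℕ) : ℤ) ω := fun t => by
    rw [Nat.range_succ_eq_Icc_zero]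
  have h2 : ∀ t : ℕ, ∑ i ∈ Finset.Icc (1 : ℕ) (t + 1), Θ ((i : ℕ) : ℤ) ω =
      ∑ i ∈ Finset.range (t + 1), Θ ((i + 1 : ℕ) : ℤ) ω := fun t => by
    induction t with
    | zero => simp
    | succ t ih => rw [Finset.sum_Icc_succ_top (by omega), ih, Finset.sum_range_succ _ (t + 1)]
  have h3 : (⨆ t : Set.Ici (1 : ℕ), ∑ i ∈ Finset.Icc (1 : ℕ) t, Θ ((i : ℕ) : ℤ) ω) =
      ⨆ t : ℕ, ∑ i ∈ Finset.range (t + 1), Θ ((i + 1 : ℕ) : ℤ) ω := by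
    symm
    refine Function.Surjective.iSup_congr (fun t : ℕ => (⟨t + 1, by simp⟩ : Set.Ici (1 : ℕ))) ?_ ?_
    · rintro ⟨t, ht⟩
      have ht : 1 ≤ t := ht
      exact ⟨t - 1, by simp only [Subtype.mk.injEq]; omega⟩
    · intro t; exact h2 t
  simp only [h1, h3]

lemma tendsto_posMax {z : ℕ → ℝ} (hz : Summable fun j => |z j|) :
    Tendsto (fun k => posMax k z) atTop (𝓝 (posSup z)) := by
  have hb : ∀ t, ∑ i ∈ Finset.range t, z i ≤ ∑' j, |z j| := fun t =>
    (Finset.sum_le_sum fun j _ => le_abs_self (z j)).trans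
      (hz.sum_le_tsum _ fun _ _ => abs_nonneg _)
  have hmono : Monotone fun k => posMax k z := fun k l hkl =>
    posMax_le_iff.2 fun s hs => sum_le_posMax z (hs.trans hkl)
  have hbdd : BddAbove (Set.range fun k => posMax k z) :=
    ⟨∑' j, |z j|, by rintro _ ⟨k, rfl⟩; exact posMax_le_iff.2 fun s _ => hb s⟩
  have hbdd' : BddAbove (Set.range fun t : ℕ => ∑ i ∈ Finset.range (t + 1), z i) :=
    ⟨∑' j, |z j|, by rintro _ ⟨k, rfl⟩; exact hb _⟩
  have h := tendsto_atTop_ciSup hmono hbdd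
  have e : (⨆ k, posMax k z) = posSup z := by
    refine le_antisymm (ciSup_le fun k => posMax_le_iff.2 fun s _ => ?_) (max_le ?_ ?_)
    · rcases s with _ | s
      · simpa using posSup_nonneg z
      · exact (le_ciSup hbdd' s).trans (le_max_left _ _)
    · exact ciSup_le fun t => (sum_le_posMax z le_rfl).trans (le_ciSup hbdd (t + 1))
    · exact (posMax_nonneg 0 z).trans (le_ciSup hbdd 0)
  rwa [e] at h

lemma tendsto_tsum_cut_sub {z : ℕ → ℝ} (hz : Summable fun j => |z j|) :
    Tendsto (fun ε : ℝ => ∑' j, |cut ε (z j) - z j|) (𝓝[>] 0) (𝓝 0) := by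
  have h := tendsto_tsum_of_dominated_convergence (𝓕 := 𝓝[>] (0 : ℝ))
    (f := fun ε j => |cut ε (z j) - z j|) (g := fun _ => (0 : ℝ)) hz (fun j => ?_) ?_
  · simpa using h
  · refine tendsto_const_nhds.congr' ?_
    by_cases hj : z j = 0
    · exact Eventually.of_forall fun ε => by simp [hj, cut_zero]
    · filter_upwards [nhdsWithin_le_nhds (gt_mem_nhds (abs_pos.2 hj))] with ε hε
      rw [cut, if_pos hε]; simp
  · refine Eventually.of_forall fun ε j => ?_
    rw [Real.norm_eq_abs, abs_abs]
    unfold cut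
    split_ifs <;> simp

/-- Thresholding and truncation of the length may be removed together, in any relative order. -/
lemma tendsto_posMax_cut {z : ℕ → ℝ} (hz : Summable fun j => |z j|) (m : ℕ) :
    Tendsto (fun q : ℝ × ℕ => posMax (q.2 + m) (fun j => cut q.1 (z j))) (𝓝[>] 0 ×ˢ atTop)
      (𝓝 (posSup z)) := by
  have h1 : Tendsto (fun q : ℝ × ℕ => posMax (q.2 + m) z) (𝓝[>] 0 ×ˢ atTop) (𝓝 (posSup z)) :=
    ((tendsto_posMax hz).comp (tendsto_add_atTop_nat m)).comp tendsto_snd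
  have h2 : Tendsto (fun q : ℝ × ℕ => posMax (q.2 + m) (fun j => cut q.1 (z j)) -
      posMax (q.2 + m) z) (𝓝[>] 0 ×ˢ atTop) (𝓝 0) := by
    refine squeeze_zero_norm (fun q => ?_) ((tendsto_tsum_cut_sub hz).comp tendsto_fst)
    have hs : Summable fun j => |cut q.1 (z j) - z j| := by
      refine hz.of_nonneg_of_le (fun _ => abs_nonneg _) fun j => ?_
      unfold cut
      split_ifs <;> simp
    exact (abs_posMax_sub_le _ _ _).trans (hs.sum_le_tsum _ fun _ _ => abs_nonneg _)
  simpa using h1.add h2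

lemma tendsto_ramp {ι : Type*} {l : Filter ι} {M a b : ι → ℝ} {a₀ b₀ : ℝ} (ρ : ℝ)
    (hM : Tendsto M l atTop) (ha : Tendsto a l (𝓝 a₀)) (hb : Tendsto b l (𝓝 b₀)) :
    Tendsto (fun i => ramp ρ (M i) (a i) (b i)) l (𝓝 (max ((b₀ - a₀) / ρ) 0)) := by
  have h : Tendsto (fun i => max ((b i - a i) / ρ) 0) l (𝓝 (max ((b₀ - a₀) / ρ) 0)) :=
    ((hb.sub ha).div_const ρ).max tendsto_const_nhds
  refine h.congr' ?_
  filter_upwards [h.eventually (gt_mem_nhds (lt_add_one _)), hM.eventually_ge_atTop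
    (max ((b₀ - a₀) / ρ) 0 + 1)] with i hi hi'
  rw [ramp, min_eq_right (hi.le.trans hi')]

/-! ### Integrals against the power measure -/

lemma measurable_powerDensity (α : ℝ) :
    Measurable fun r : ℝ => ENNReal.ofReal (α * r ^ (-α - 1)) := by fun_prop

lemma powerDensity_smul {α : ℝ} (hα : 0 < α) (g : ℝ → ℝ) {r : ℝ} (hr : r ∈ Set.Ioi (0 : ℝ)) :
    (ENNReal.ofReal (α * r ^ (-α - 1))).toReal • g r = α * r ^ (-α - 1) * g r := by
  have hr : 0 < r := hr
  rw [ENNReal.toReal_ofReal (by positivity), smul_eq_mul]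

lemma integrable_powerMeasure_iff {α : ℝ} (hα : 0 < α) {g : ℝ → ℝ} :
    Integrable g (powerMeasure α) ↔
      IntegrableOn (fun r => α * r ^ (-α - 1) * g r) (Set.Ioi 0) := by
  unfold powerMeasure
  rw [integrable_withDensity_iff_integrable_smul' (measurable_powerDensity α)
    (ae_of_all _ fun _ => ENNReal.ofReal_lt_top)]
  exact integrableOn_congr_fun (fun r hr => powerDensity_smul hα g hr) measurableSet_Ioi

lemma integral_powerMeasure {α : ℝ} (hα : 0 < α) (g : ℝ → ℝ) :
    ∫ r, g r ∂(powerMeasure α) = ∫ r in Set.Ioi 0, α * r ^ (-α - 1) * g r := by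
  unfold powerMeasure
  rw [integral_withDensity_eq_integral_toReal_smul (measurable_powerDensity α)
    (ae_of_all _ fun _ => ENNReal.ofReal_lt_top)]
  exact setIntegral_congr_fun measurableSet_Ioi fun r hr => powerDensity_smul hα g hr

lemma ae_powerMeasure_pos (α : ℝ) : ∀ᵐ r ∂(powerMeasure α), 0 < r :=
  (withDensity_absolutelyContinuous _ _).ae_le
    ((ae_restrict_iff' measurableSet_Ioi).2 (ae_of_all _ fun _ hr => hr))

/-- Integrals of functions carried by a half line `(c, ∞)`. -/
lemma powerMeasure_halfLine {α : ℝ} (hα : 0 < α) {c : ℝ} (hc : 0 < c) {g h : ℝ → ℝ}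
    (hle : ∀ r, 0 < r → r ≤ c → g r = 0) (hgt : ∀ r, c < r → α * r ^ (-α - 1) * g r = h r)
    (hi : IntegrableOn h (Set.Ioi c)) :
    Integrable g (powerMeasure α) ∧ ∫ r, g r ∂(powerMeasure α) = ∫ r in Set.Ioi c, h r := by
  have e : Set.EqOn (fun r => α * r ^ (-α - 1) * g r) ((Set.Ioi c).indicator h) (Set.Ioi 0) := by
    intro r (hr : 0 < r)
    by_cases hrc : c < r
    · simp only [Set.indicator_of_mem (show r ∈ Set.Ioi c from hrc), hgt r hrc]
    · simp only [Set.indicator_of_notMem (show r ∉ Set.Ioi c from hrc), hle r hr (not_lt.1 hrc),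
        mul_zero]
  have hsub : Set.Ioi c ⊆ Set.Ioi (0 : ℝ) := Set.Ioi_subset_Ioi hc.le
  constructor
  · rw [integrable_powerMeasure_iff hα, integrableOn_congr_fun e measurableSet_Ioi]
    exact (hi.integrable_indicator measurableSet_Ioi).integrableOn
  · rw [integral_powerMeasure hα, setIntegral_congr_fun measurableSet_Ioi e,
      setIntegral_indicator measurableSet_Ioi, Set.inter_eq_right.2 hsub]

/-- The `α - 1` moment of the total absolute sum enters through this integral. -/
lemma powerMeasure_linear {α ρ W : ℝ} (hα : 1 < α) (hρ : 0 < ρ) (hW : 0 < W) :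
    Integrable (fun r => if 1 / 2 < r * W then r / ρ else 0) (powerMeasure α) ∧
      ∫ r, (if 1 / 2 < r * W then r / ρ else 0) ∂(powerMeasure α) =
        α / ρ * 2 ^ (α - 1) / (α - 1) * W ^ (α - 1) := by
  have hc : 0 < (2 * W)⁻¹ := by positivity
  have hiff : ∀ r : ℝ, 1 / 2 < r * W ↔ (2 * W)⁻¹ < r := fun r => by
    rw [inv_lt_iff_one_lt_mul₀ (by positivity)]
    constructor <;> intro h <;> linarith
  obtain ⟨h1, h2⟩ := powerMeasure_halfLine (α := α) (by linarith) hc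
    (g := fun r => if 1 / 2 < r * W then r / ρ else 0) (h := fun r => α / ρ * r ^ (-α))
    (fun r _ hr => if_neg (by rw [hiff]; exact hr.not_gt))
    (fun r hr => by
      have hr0 : 0 < r := hc.trans hr
      simp only [if_pos ((hiff r).2 hr)]
      rw [Real.rpow_sub_one hr0.ne']
      field_simp)
    ((integrableOn_Ioi_rpow_of_lt (by linarith) hc).const_mul _)
  refine ⟨h1, ?_⟩
  rw [h2, integral_const_mul, integral_Ioi_rpow_of_lt (by linarith) hc,
    Real.inv_rpow (by positivity), ← Real.rpow_neg (by positivity),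
    show -(-α + 1) = α - 1 by ring, Real.mul_rpow (by norm_num) hW.le,
    show -α + 1 = -(α - 1) by ring]
  have : α - 1 ≠ 0 := by linarith
  field_simp

/-- The supremum enters the limit through its `α`-th power. -/
lemma powerMeasure_ramp {α ρ A : ℝ} (hα : 1 < α) (hρ : 0 < ρ) (hA : 0 ≤ A) :
    Integrable (fun r => max ((r * A - 1) / ρ) 0) (powerMeasure α) ∧
      ∫ r, max ((r * A - 1) / ρ) 0 ∂(powerMeasure α) = A ^ α / ((α - 1) * ρ) := by
  rcases hA.eq_or_lt with rfl | hA
  · have : ∀ r : ℝ, max ((r * 0 - 1) / ρ) 0 = 0 := fun r => by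
      rw [mul_zero, zero_sub, max_eq_right]
      exact div_nonpos_of_nonpos_of_nonneg (by norm_num) hρ.le
    simp only [this]
    refine ⟨integrable_zero _ _ _, ?_⟩
    rw [integral_zero, Real.zero_rpow (by linarith), zero_div]
  have hc : 0 < A⁻¹ := by positivity
  have hiff : ∀ r : ℝ, A⁻¹ < r ↔ 1 < r * A := fun r => by
    rw [inv_lt_iff_one_lt_mul₀ hA, mul_comm]
  have i1 : IntegrableOn (fun r : ℝ => α / ρ * A * r ^ (-α)) (Set.Ioi A⁻¹) :=
    (integrableOn_Ioi_rpow_of_lt (by linarith) hc).const_mul _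
  have i2 : IntegrableOn (fun r : ℝ => α / ρ * r ^ (-α - 1)) (Set.Ioi A⁻¹) :=
    (integrableOn_Ioi_rpow_of_lt (by linarith) hc).const_mul _
  obtain ⟨h1, h2⟩ := powerMeasure_halfLine (α := α) (by linarith) hc
    (g := fun r => max ((r * A - 1) / ρ) 0)
    (h := fun r => α / ρ * A * r ^ (-α) - α / ρ * r ^ (-α - 1))
    (fun r _ hr => by
      rw [max_eq_right]
      refine div_nonpos_of_nonpos_of_nonneg ?_ hρ.le
      have := mt (hiff r).2 hr.not_gt
      linarith)
    (fun r hr => by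
      have hr0 : 0 < r := hc.trans hr
      have := (hiff r).1 hr
      rw [max_eq_left (div_nonneg (by linarith) hρ.le), Real.rpow_sub_one hr0.ne']
      field_simp)
    (i1.sub i2)
  refine ⟨h1, ?_⟩
  rw [h2, integral_sub i1 i2, integral_const_mul, integral_const_mul,
    integral_Ioi_rpow_of_lt (by linarith) hc, integral_Ioi_rpow_of_lt (by linarith) hc,
    Real.inv_rpow hA.le, Real.inv_rpow hA.le, ← Real.rpow_neg hA.le, ← Real.rpow_neg hA.le,
    show -(-α + 1) = α - 1 by ring, show -(-α - 1 + 1) = α by ring, Real.rpow_sub_one hA.ne',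
    show -α + 1 = -(α - 1) by ring, show -α - 1 + 1 = -α by ring]
  have h3 : α - 1 ≠ 0 := by linarith
  have h4 : α ≠ 0 := by linarith
  field_simp
  ring

/-! ### Evaluation of the cluster limits -/

section Limit

variable {Ω' : Type*} {Θ : ℤ → Ω' → ℝ} {α ρ : ℝ}

/-- The sum `1 + ∑_{i ≥ 1} |Θ_i|`. -/
def totalAbs (Θ : ℤ → Ω' → ℝ) (ω : Ω') : ℝ := 1 + (∑' i : ℕ, ‖Θ ((i : ℤ) + 1) ω‖ₑ).toReal

lemma one_le_totalAbs (Θ : ℤ → Ω' → ℝ) (ω : Ω') : 1 ≤ totalAbs Θ ω :=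
  le_add_of_nonneg_right ENNReal.toReal_nonneg

lemma hasSum_abs_tail {ω : Ω'} (h : (∑' i : ℕ, ‖Θ ((i : ℤ) + 1) ω‖ₑ) ≠ ∞) :
    HasSum (fun j : ℕ => |Θ ((j + 1 : ℕ) : ℤ) ω|) (totalAbs Θ ω - 1) := by
  have h1 := ENNReal.tsum_toReal_eq (f := fun i : ℕ => ‖Θ ((i : ℤ) + 1) ω‖ₑ) fun i => by finiteness
  have h2 := ENNReal.summable_toReal h
  have h3 := h2.hasSum
  rw [← h1] at h3
  simpa [totalAbs] using h3

/-- The limiting integrand: the increments of the ramp functional of the rescaled suprema. -/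
def limitGain (Θ : ℤ → Ω' → ℝ) (ρ : ℝ) (p : ℝ × Ω') : ℝ :=
  max ((p.1 * posSup (fun j : ℕ => Θ j p.2) - 1) / ρ) 0 -
    max ((p.1 * posSup (fun j : ℕ => Θ ((j + 1 : ℕ) : ℤ) p.2) - 1) / ρ) 0

lemma integral_limitGain_section (hα : 1 < α) (hρ : 0 < ρ) (ω : Ω') :
    ∫ r, limitGain Θ ρ (r, ω) ∂(powerMeasure α) = ruinFunctional α Θ ω / ((α - 1) * ρ) := by
  have h1 := powerMeasure_ramp hα hρ (posSup_nonneg fun j : ℕ => Θ j ω)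
  have h2 := powerMeasure_ramp hα hρ (posSup_nonneg fun j : ℕ => Θ ((j + 1 : ℕ) : ℤ) ω)
  unfold limitGain
  rw [integral_sub h1.1 h2.1, h1.2, h2.2, ruinFunctional_eq, sub_div]

variable [MeasurableSpace Ω'] {Q : Measure Ω'}

lemma measurable_totalAbs (hΘm : ∀ t, Measurable (Θ t)) : Measurable (totalAbs Θ) :=
  (Measurable.tsum fun _ => (hΘm _).enorm).ennreal_toReal.const_add 1

lemma ae_tsum_ne_top (hα : 1 < α) (hΘm : ∀ t, Measurable (Θ t))
    (hΘ : ∫⁻ ω, (∑' i : ℕ, ‖Θ ((i : ℤ) + 1) ω‖ₑ) ^ (α - 1) ∂Q < ∞) :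
    ∀ᵐ ω ∂Q, (∑' i : ℕ, ‖Θ ((i : ℤ) + 1) ω‖ₑ) ≠ ∞ := by
  have mV : Measurable fun ω => ∑' i : ℕ, ‖Θ ((i : ℤ) + 1) ω‖ₑ :=
    Measurable.tsum fun _ => (hΘm _).enorm
  filter_upwards [ae_lt_top (mV.pow_const (α - 1)) hΘ.ne] with ω hω
  exact ((ENNReal.rpow_lt_top_iff_of_pos (by linarith)).1 hω).ne

/-- The properties of `(r, Θ)`, valid almost everywhere, under which the pointwise limits hold. -/
lemma ae_prod_good (hα : 1 < α) (hΘm : ∀ t, Measurable (Θ t)) (hΘ0 : ∀ᵐ ω ∂Q, |Θ 0 ω| = 1)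
    (hΘ : ∫⁻ ω, (∑' i : ℕ, ‖Θ ((i : ℤ) + 1) ω‖ₑ) ^ (α - 1) ∂Q < ∞) :
    ∀ᵐ p ∂((powerMeasure α).prod Q), 0 < p.1 ∧ |Θ 0 p.2| = 1 ∧
      HasSum (fun j : ℕ => |Θ j p.2|) (totalAbs Θ p.2) := by
  have h1 := Measure.quasiMeasurePreserving_fst (μ := powerMeasure α) (ν := Q) |>.ae
    (ae_powerMeasure_pos α)
  have h2 := Measure.quasiMeasurePreserving_snd (μ := powerMeasure α) (ν := Q) |>.ae
    (hΘ0.and (ae_tsum_ne_top hα hΘm hΘ))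
  filter_upwards [h1, h2] with p hp1 hp2
  refine ⟨hp1, hp2.1, ?_⟩
  have h3 := hasSum_abs_tail hp2.2
  have h4 := (hasSum_nat_add_iff (f := fun j : ℕ => |Θ j p.2|) 1).1 h3
  simpa [hp2.1] using h4

variable [IsProbabilityMeasure Q]

lemma integrable_totalAbs_rpow (hα : 1 < α) (hΘm : ∀ t, Measurable (Θ t))
    (hΘ : ∫⁻ ω, (∑' i : ℕ, ‖Θ ((i : ℤ) + 1) ω‖ₑ) ^ (α - 1) ∂Q < ∞) :
    Integrable (fun ω => totalAbs Θ ω ^ (α - 1)) Q := by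
  have mV : Measurable fun ω => ∑' i : ℕ, ‖Θ ((i : ℤ) + 1) ω‖ₑ :=
    Measurable.tsum fun _ => (hΘm _).enorm
  have h1 := integrable_toReal_of_lintegral_ne_top (mV.pow_const (α - 1)).aemeasurable hΘ.ne
  have hα' : 0 ≤ α - 1 := by linarith
  refine (((integrable_const (1 : ℝ)).add h1).const_mul (2 ^ (α - 1))).mono'
    ((measurable_totalAbs hΘm).pow_const _).aestronglyMeasurable (ae_of_all _ fun ω => ?_)
  have hW := one_le_totalAbs Θ ω
  rw [Real.norm_eq_abs, abs_of_nonneg (Real.rpow_nonneg (by linarith) _)]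
  simp only [Pi.add_apply, ← ENNReal.toReal_rpow]
  set v : ℝ := (∑' i : ℕ, ‖Θ ((i : ℤ) + 1) ω‖ₑ).toReal with hv
  have hv0 : 0 ≤ v := ENNReal.toReal_nonneg
  have hWv : totalAbs Θ ω = 1 + v := rfl
  have hvα : 0 ≤ v ^ (α - 1) := Real.rpow_nonneg hv0 _
  rw [hWv]
  rcases le_total v 1 with h | h
  · calc (1 + v) ^ (α - 1) ≤ 2 ^ (α - 1) := Real.rpow_le_rpow (by linarith) (by linarith) hα'
      _ ≤ 2 ^ (α - 1) * (1 + v ^ (α - 1)) :=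
          le_mul_of_one_le_right (by positivity) (by linarith)
  · calc (1 + v) ^ (α - 1) ≤ (2 * v) ^ (α - 1) :=
          Real.rpow_le_rpow (by linarith) (by linarith) hα'
      _ = 2 ^ (α - 1) * v ^ (α - 1) := Real.mul_rpow (by norm_num) hv0
      _ ≤ 2 ^ (α - 1) * (1 + v ^ (α - 1)) := by gcongr; linarith

/-- The dominating function of the limit: integrable by the moment condition. -/
lemma integrable_bound (hα : 1 < α) (hρ : 0 < ρ) (hΘm : ∀ t, Measurable (Θ t))
    (hΘ : ∫⁻ ω, (∑' i : ℕ, ‖Θ ((i : ℤ) + 1) ω‖ₑ) ^ (α - 1) ∂Q < ∞) :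
    Integrable (fun p : ℝ × Ω' => if 1 / 2 < p.1 * totalAbs Θ p.2 then p.1 / ρ else 0)
      ((powerMeasure α).prod Q) := by
  have mb : Measurable fun p : ℝ × Ω' =>
      if 1 / 2 < p.1 * totalAbs Θ p.2 then p.1 / ρ else 0 :=
    Measurable.ite (measurableSet_lt measurable_const
      (measurable_fst.mul ((measurable_totalAbs hΘm).comp measurable_snd)))
      (measurable_fst.div_const ρ) measurable_const
  rw [integrable_prod_iff' mb.aestronglyMeasurable]
  have hW : ∀ ω, 0 < totalAbs Θ ω := fun ω => one_pos.trans_le (one_le_totalAbs Θ ω)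
  refine ⟨ae_of_all _ fun ω => (powerMeasure_linear hα hρ (hW ω)).1, ?_⟩
  have e : ∀ ω, ∫ r, ‖(if 1 / 2 < r * totalAbs Θ ω then r / ρ else 0)‖ ∂(powerMeasure α) =
      α / ρ * 2 ^ (α - 1) / (α - 1) * totalAbs Θ ω ^ (α - 1) := fun ω => by
    rw [← (powerMeasure_linear hα hρ (hW ω)).2]
    refine integral_congr_ae ((ae_powerMeasure_pos α).mono fun r hr => ?_)
    simp only
    split_ifs
    · rw [Real.norm_eq_abs, abs_of_pos (div_pos hr hρ)]
    · exact norm_zero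
  simp only [e]
  exact (integrable_totalAbs_rpow hα hΘm hΘ).const_mul _

lemma posSup_const_mul {z : ℕ → ℝ} (hz : Summable fun j => |z j|) {r : ℝ} (hr : 0 ≤ r) :
    posSup (fun j => r * z j) = r * posSup z := by
  have hz' : Summable fun j => |r * z j| := by
    simp only [abs_mul]; exact hz.mul_left _
  refine tendsto_nhds_unique (tendsto_posMax hz') ?_
  simp only [posMax_const_mul hr]
  exact (tendsto_posMax hz).const_mul r

/-- Pointwise convergence of the gains, jointly in horizon, level, threshold and cluster length. -/
lemma tendsto_gain_pointwise {z : ℕ → ℝ} (hz : Summable fun j => |z j|) (ρ : ℝ) {r : ℝ}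
    (hr : 0 < r) :
    Tendsto (fun q : ℝ × ℝ × ℝ × ℕ =>
        if q.2.2.1 < r then gain ρ q.1 q.2.1 q.2.2.2 (fun j => cut q.2.2.1 (r * z j)) else 0)
      (atTop ×ˢ 𝓝 1 ×ˢ 𝓝[>] 0 ×ˢ atTop)
      (𝓝 (max ((r * posSup z - 1) / ρ) 0 -
        max ((r * posSup (fun j => z (j + 1)) - 1) / ρ) 0)) := by
  have hz1 : Summable fun j => |z (j + 1)| := (summable_nat_add_iff 1).2 hz
  have hrz : Summable fun j => |r * z j| := by simp only [abs_mul]; exact hz.mul_left _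
  have hrz1 : Summable fun j => |r * z (j + 1)| := (summable_nat_add_iff 1).2 hrz
  have p1 : Tendsto (fun q : ℝ × ℝ × ℝ × ℕ => q.1)
      (atTop ×ˢ 𝓝 1 ×ˢ 𝓝[>] 0 ×ˢ atTop) atTop := tendsto_fst
  have p2 : Tendsto (fun q : ℝ × ℝ × ℝ × ℕ => q.2.1)
      ((atTop : Filter ℝ) ×ˢ 𝓝 1 ×ˢ 𝓝[>] 0 ×ˢ atTop) (𝓝 1) := tendsto_fst.comp tendsto_snd
  have p3 : Tendsto (fun q : ℝ × ℝ × ℝ × ℕ => q.2.2)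
      ((atTop : Filter ℝ) ×ˢ (𝓝 1 : Filter ℝ) ×ˢ 𝓝[>] 0 ×ˢ atTop) (𝓝[>] 0 ×ˢ atTop) :=
    tendsto_snd.comp tendsto_snd
  have h1 := tendsto_ramp ρ p1 p2 ((tendsto_posMax_cut hrz 1).comp p3)
  have h2 := tendsto_ramp ρ p1 p2 ((tendsto_posMax_cut hrz1 0).comp p3)
  rw [posSup_const_mul hz hr.le] at h1
  rw [posSup_const_mul hz1 hr.le] at h2
  refine (h1.sub h2).congr' ?_
  have h3 : ∀ᶠ q : ℝ × ℝ × ℝ × ℕ in (atTop : Filter ℝ) ×ˢ (𝓝 1 : Filter ℝ) ×ˢ 𝓝[>] 0 ×ˢ atTop,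
      q.2.2.1 < r :=
    (tendsto_fst.comp p3).eventually (nhdsWithin_le_nhds (gt_mem_nhds hr))
  filter_upwards [h3] with q hq
  rw [if_pos hq]
  rfl

/-- The cluster limit as an integral against one fixed measure. -/
lemma clusterLimit_eq (Q : Measure Ω') [IsProbabilityMeasure Q] (α : ℝ) (Θ : ℤ → Ω' → ℝ)
    (ρ M a ε : ℝ) (k : ℕ) :
    clusterLimit Q α Θ ρ M a ε k = ∫ p : ℝ × Ω',
      (if ε < p.1 then gain ρ M a k (fun j => cut ε (p.1 * Θ j p.2)) else 0)
        ∂((powerMeasure α).prod Q) := by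
  unfold clusterLimit
  have h := Measure.prod_restrict (μ := powerMeasure α) (ν := Q) (Set.Ioi ε) Set.univ
  rw [Measure.restrict_univ] at h
  rw [h, ← integral_indicator (measurableSet_Ioi.prod MeasurableSet.univ)]
  refine integral_congr_ae (ae_of_all _ fun p => ?_)
  by_cases hp : ε < p.1
  · rw [Set.indicator_of_mem (show p ∈ Set.Ioi ε ×ˢ Set.univ from ⟨hp, trivial⟩)]
    exact (if_pos hp).symm
  · rw [Set.indicator_of_notMem (fun h : p ∈ Set.Ioi ε ×ˢ Set.univ => hp h.1)]
    exact (if_neg hp).symm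

/-- The limit of the cluster functionals, by dominated convergence on the product space. -/
lemma tendsto_clusterLimit (hα : 1 < α) (hρ : 0 < ρ) (hΘm : ∀ t, Measurable (Θ t))
    (hΘ0 : ∀ᵐ ω ∂Q, |Θ 0 ω| = 1)
    (hΘ : ∫⁻ ω, (∑' i : ℕ, ‖Θ ((i : ℤ) + 1) ω‖ₑ) ^ (α - 1) ∂Q < ∞) :
    Integrable (limitGain Θ ρ) ((powerMeasure α).prod Q) ∧
    Tendsto (fun q : ℝ × ℝ × ℝ × ℕ => clusterLimit Q α Θ ρ q.1 q.2.1 q.2.2.1 q.2.2.2)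
      (atTop ×ˢ 𝓝 1 ×ˢ 𝓝[>] 0 ×ˢ atTop)
      (𝓝 (∫ p, limitGain Θ ρ p ∂((powerMeasure α).prod Q))) := by
  set F : ℝ × ℝ × ℝ × ℕ → ℝ × Ω' → ℝ := fun q p =>
    if q.2.2.1 < p.1 then gain ρ q.1 q.2.1 q.2.2.2 (fun j => cut q.2.2.1 (p.1 * Θ j p.2)) else 0
    with hF
  set b : ℝ × Ω' → ℝ := fun p => if 1 / 2 < p.1 * totalAbs Θ p.2 then p.1 / ρ else 0 with hb
  set l : Filter (ℝ × ℝ × ℝ × ℕ) := atTop ×ˢ 𝓝 1 ×ˢ 𝓝[>] 0 ×ˢ atTop with hl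
  have hgood := ae_prod_good (Q := Q) hα hΘm hΘ0 hΘ
  have mF : ∀ q, Measurable (F q) := fun q => by
    refine Measurable.ite (measurableSet_lt measurable_const measurable_fst) ?_ measurable_const
    have h := (continuous_gain ρ q.1 q.2.1 q.2.2.2).measurable.comp
      (measurable_pi_iff.2 fun j : ℕ => (measurable_cut q.2.2.1).comp
        (measurable_fst.mul ((hΘm j).comp (measurable_snd (α := ℝ)))))
    exact h
  have hlim : ∀ᵐ p ∂((powerMeasure α).prod Q),
      Tendsto (fun q => F q p) l (𝓝 (limitGain Θ ρ p)) := by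
    filter_upwards [hgood] with p hp
    have h := tendsto_gain_pointwise hp.2.2.summable ρ hp.1
    exact h
  have hbound : ∀ᶠ q in l, ∀ᵐ p ∂((powerMeasure α).prod Q), ‖F q p‖ ≤ b p := by
    have e1 : ∀ᶠ q in l, (0 : ℝ) ≤ q.1 := (tendsto_fst (f := atTop)).eventually_ge_atTop 0
    have p2 : Tendsto (fun q : ℝ × ℝ × ℝ × ℕ => q.2.1) l (𝓝 1) := tendsto_fst.comp tendsto_snd
    have e2 : ∀ᶠ q in l, (1 / 2 : ℝ) < q.2.1 := p2.eventually (lt_mem_nhds (by norm_num))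
    filter_upwards [e1, e2] with q hq1 hq2
    filter_upwards [hgood] with p ⟨hp1, hp2, hp3⟩
    have hb0 : 0 ≤ b p := by
      simp only [hb]
      split_ifs
      · positivity
      · exact le_rfl
    simp only [hF]
    split_ifs with hε
    · rw [Real.norm_eq_abs]
      refine (abs_gain_le_of_sum (W := p.1 * totalAbs Θ p.2) hρ hq1 q.2.2.2 _ ?_).trans ?_
      · calc ∑ j ∈ Finset.range (q.2.2.2 + 1), |cut q.2.2.1 (p.1 * Θ j p.2)| ≤
            ∑ j ∈ Finset.range (q.2.2.2 + 1), p.1 * |Θ j p.2| :=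
              Finset.sum_le_sum fun j _ => (abs_cut_le _ _).trans
                (by rw [abs_mul, abs_of_pos hp1])
          _ = p.1 * ∑ j ∈ Finset.range (q.2.2.2 + 1), |Θ j p.2| := by rw [Finset.mul_sum]
          _ ≤ p.1 * totalAbs Θ p.2 := mul_le_mul_of_nonneg_left
              (sum_le_hasSum _ (fun _ _ => abs_nonneg _) hp3) hp1.le
      · split_ifs with hW
        · simp only [hb]
          rw [if_pos (by linarith)]
          refine div_le_div_of_nonneg_right ((abs_cut_le _ _).trans ?_) hρ.le
          rw [abs_mul, abs_of_pos hp1, Nat.cast_zero, hp2, mul_one]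
        · exact hb0
    · rw [norm_zero]; exact hb0
  have hbi := integrable_bound (Q := Q) hα hρ hΘm hΘ
  refine ⟨?_, ?_⟩
  · refine hbi.mono' (aestronglyMeasurable_of_tendsto_ae l
      (fun q => (mF q).aestronglyMeasurable) hlim) ?_
    -- evaluate the bound along a sequence, so that the exceptional null sets can be united
    obtain ⟨u, hu⟩ := exists_seq_tendsto l
    obtain ⟨n₀, hn₀⟩ := eventually_atTop.1 (hu.eventually hbound)
    have hall : ∀ᵐ p ∂((powerMeasure α).prod Q), ∀ n, ‖F (u (n + n₀)) p‖ ≤ b p :=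
      ae_all_iff.2 fun n => hn₀ _ (Nat.le_add_left _ _)
    filter_upwards [hlim, hall] with p hp1 hp2
    refine le_of_tendsto ((hp1.comp (hu.comp (tendsto_add_atTop_nat n₀))).norm) ?_
    exact Eventually.of_forall fun n => hp2 n
  · simp only [clusterLimit_eq]
    exact tendsto_integral_filter_of_dominated_convergence b
      (Eventually.of_forall fun q => (mF q).aestronglyMeasurable) hbound hbi hlim

lemma integrable_ruinFunctional (hα : 1 < α) (hΘm : ∀ t, Measurable (Θ t))
    (hΘ0 : ∀ᵐ ω ∂Q, |Θ 0 ω| = 1)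
    (hΘ : ∫⁻ ω, (∑' i : ℕ, ‖Θ ((i : ℤ) + 1) ω‖ₑ) ^ (α - 1) ∂Q < ∞) :
    Integrable (ruinFunctional α Θ) Q := by
  have h := (tendsto_clusterLimit (Q := Q) hα one_pos hΘm hΘ0 hΘ).1.integral_prod_right
  simp only [integral_limitGain_section hα one_pos, mul_one] at h
  refine (h.mul_const (α - 1)).congr (ae_of_all _ fun ω => ?_)
  exact div_mul_cancel₀ _ (by linarith)

lemma integral_limitGain (hα : 1 < α) (hρ : 0 < ρ) (hΘm : ∀ t, Measurable (Θ t))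
    (hΘ0 : ∀ᵐ ω ∂Q, |Θ 0 ω| = 1)
    (hΘ : ∫⁻ ω, (∑' i : ℕ, ‖Θ ((i : ℤ) + 1) ω‖ₑ) ^ (α - 1) ∂Q < ∞) :
    ∫ p, limitGain Θ ρ p ∂((powerMeasure α).prod Q) =
      (∫ ω, ruinFunctional α Θ ω ∂Q) / ((α - 1) * ρ) := by
  rw [integral_prod_symm _ (tendsto_clusterLimit (Q := Q) hα hρ hΘm hΘ0 hΘ).1]
  simp only [integral_limitGain_section hα hρ]
  rw [integral_div]

end Limit

end

end RuinLD

theorem theorem4p5 {Ω Ω' : Type*} [MeasurableSpace Ω] [MeasurableSpace Ω']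
    (P : Measure Ω) [IsProbabilityMeasure P] (Q : Measure Ω') [IsProbabilityMeasure Q]
    (α : ℝ) (hα : 1 < α)
    (X : ℤ → Ω → ℝ) (hXm : ∀ t, Measurable (X t))
    (hstat : RuinLD.StrictlyStationary P X)
    (hRV : RuinLD.RegularlyVaryingSeq P α X)
    (hmean : ∫ ω, X 0 ω ∂P = 0)
    (Y : ℤ → Ω' → ℝ) (hY : RuinLD.IsTailProcess P α X Q Y)
    (hAC : ∀ C₁ C₂ : ℝ, 0 < C₁ → C₁ < C₂ →
      RuinLD.AntiClustering P X (fun n => Set.Icc (C₁ * n) (C₂ * n)))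
    (hVSV : ∀ C₁ C₂ : ℝ, 0 < C₁ → C₁ < C₂ →
      RuinLD.VanishingSmallValues P X (fun n => Set.Icc (C₁ * n) (C₂ * n)))
    (hΘ : ∫⁻ ω, (∑' i : ℕ, ‖RuinLD.spectralTail Y ((i : ℤ) + 1) ω‖ₑ) ^ (α - 1) ∂Q < ∞) :
    Integrable (RuinLD.ruinFunctional α (RuinLD.spectralTail Y)) Q ∧
    ∀ ρ : ℝ, 0 < ρ →
      Tendsto (fun x : ℝ => RuinLD.ruinProb P X ρ x / (x * P.real {ω | x < |X 0 ω|})) atTop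
        (𝓝 ((∫ ω, RuinLD.ruinFunctional α (RuinLD.spectralTail Y) ω ∂Q) / ((α - 1) * ρ))) := by
  have hΘm := hY.measurable_spectralTail
  have hΘ0 : ∀ᵐ ω ∂Q, |RuinLD.spectralTail Y 0 ω| = 1 := by
    filter_upwards [hY.ae_one_lt] with ω hω
    rw [RuinLD.spectralTail, abs_div, abs_abs, div_self (by linarith)]
  refine ⟨RuinLD.integrable_ruinFunctional hα hΘm hΘ0 hΘ, fun ρ hρ => ?_⟩
  refine hY.tendsto_ruinProb hα hXm hstat hRV hAC hVSV hρ fun κ hκ => ?_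
  have h := (RuinLD.tendsto_clusterLimit (Q := Q) hα hρ hΘm hΘ0 hΘ).2
  rw [RuinLD.integral_limitGain hα hρ hΘm hΘ0 hΘ] at h
  have h1 := (Metric.tendsto_nhds.1 h κ hκ).curry
  filter_upwards [h1] with M hM
  filter_upwards [hM.curry] with a ha
  exact ha.curry
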